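/- Let $\alpha>0$ and $0<p\le 2$, let $s$ be the largest integer strictly less than $\alpha$, and put $\beta=\alpha-s\in(0,1]$. For $d\in\mathbb N$ let $\Omega=\{x\in\mathbb R^d:\|x\|_2\le 1\}$. For $g\in C^s[-1,1]$ (derivatives up to order $s$ exist in $(-1,1)$ and extend continuously to $[-1,1]$) set $$\|g\|_{\mathrm{Lip}_\alpha[-1,1]}=\max\Big\{\max_{k\le s}\|g^{(k)}\|_\infty,\ \sup_{t\ne u\in[-1,1]}\frac{|g^{(s)}(t)-g^{(s)}(u)|}{2\min\{1,|t-u|\}^{\beta}}\Big\},$$ and let $$\mathcal R_d^{\alpha,p}=\big\{f:\Omega\to\mathbb R:\ f(x)=g(a\cdot x),\ g\in C^s[-1,1],\ \|g\|_{\mathrm{Lip}_\alpha[-1,1]}\le 1,\ a\in\mathbb R^d,\ \|a\|_p\le 1\big\},$$ where $\|a\|_p=(\sum_i|a_i|^p)^{1/p}$. An adaptive sampling algorithm with budget $n$ is a map $S=\varphi\circ N$, where for some $m\le n$ the map $N$ sends $f$ to $(f(x_1),\dots,f(x_m))\in\mathbb R^m$ with points $x_i\in\Omega$, each $x_i$ being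 allowed to depend on $f(x_1),\dots,f(x_{i-1})$, and $\varphi:\mathbb R^m\to L_\infty(\Omega)$ is an arbitrary map with $\varphi(0)=0$. It is called linear if the points $x_1,\dots,x_m$ are fixed in advance and $\varphi$ is linear. The $n$-th adaptive sampling number $g^{\mathrm{ada}}_{n,d}(\mathcal R_d^{\alpha,p},L_\infty)$ is the infimum of $\sup_{f\in\mathcal R_d^{\alpha,p}}\|f-S(f)\|_{L_\infty(\Omega)}$ over all adaptive sampling algorithms $S$ with budget $n$; the $n$-th linear sampling number $g^{\mathrm{lin}}_{n,d}(\mathcal R_d^{\alpha,p},L_\infty)$ is the same infimum over all linear ones. Write $\log=\log_2$. **Theorem.** There are constants $C_{p,\alpha},c_{p,\alpha}>0$ depending only on $p$ and $\alpha$ such that the following holds. (i) For all $d\ge 1$ and all $n$, with $n_1=n/\big[2\binom{d+s}{s}\big]$, $$g^{\mathrm{lin}}_{n,d}(\mathcal R_d^{\alpha,p},L_\infty)\le C_{p,\alpha}\begin{cases}1 &: n\le 2d\binom{d+s}{s},\\ \Big[\dfrac{\log(1+d/\log n_1)}{\log n_1}\Big]^{\alpha(1/\max\{1,p\}-1/2)}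 &: 2d\binom{d+s}{s}<n\le 2^{d+1}\binom{d+s}{s},\\ n^{-\alpha/d}\,d^{-\alpha(1/\max\{1,p\}-1/2)} &: n>2^{d+1}\binom{d+s}{s}.\end{cases}$$ (ii) For all $d\ge 2$ and all $n$, $$g^{\mathrm{ada}}_{n,d}(\mathcal R_d^{\alpha,p},L_\infty)\ge c_{p,\alpha}\begin{cases}1 &: n<d,\\ \Big[\dfrac{\log(1+d/(2+\log n))}{2+\log n}\Big]^{\alpha(1/p-1/2)} &: d\le n<2^{d-1},\\ n^{-2\alpha/(d-1)}\,d^{-\alpha(1/p-1/2)} &: n\ge 2^{d-1}.\end{cases}$$ -/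

import Mathlib

open MeasureTheory Set
open scoped ENNReal

noncomputable section

/-- The largest natural number strictly less than `α` (for `α > 0`). -/
def strictFloor (α : ℝ) : ℕ := ⌈α⌉₊ - 1

/-- The `k`-th derivative of a profile on `[-1,1]` (one-sided at the end points, so that for
profiles of class `C^k` it is the continuous extension of the derivative on the interior). -/
def profileDeriv (k : ℕ) (g : ℝ → ℝ) : ℝ → ℝ := iteratedDerivWithin k g (Icc (-1) 1)

/-- The norm of `C^s[-1,1]`: the maximum of the sup-norms of the derivatives up to order `s`. -/
def cNorm (s : ℕ) (g : ℝ → ℝ) : ℝ≥0∞ :=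
  ⨆ k : ℕ, ⨆ _ : k ≤ s, ⨆ t ∈ Icc (-1 : ℝ) 1, ENNReal.ofReal |profileDeriv k g t|

/-- The Hölder constant of order `β` on `[-1,1]`, with the normalisation
`|h(t) - h(u)| / (2 min {1, |t - u|}^β)`. -/
def holderConst (β : ℝ) (h : ℝ → ℝ) : ℝ≥0∞ :=
  ⨆ t ∈ Icc (-1 : ℝ) 1, ⨆ u ∈ Icc (-1 : ℝ) 1, ⨆ _ : t ≠ u,
    ENNReal.ofReal (|h t - h u| / (2 * (min 1 |t - u|) ^ β))

/-- The norm of `Lip_α[-1,1]`. -/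
def lipNorm (α : ℝ) (g : ℝ → ℝ) : ℝ≥0∞ :=
  max (cNorm (strictFloor α) g)
    (holderConst (α - strictFloor α) (profileDeriv (strictFloor α) g))

/-- The closed unit ball of `Lip_α[-1,1]`; only the values of `g` on `[-1,1]` matter. -/
def lipUnitBall (α : ℝ) : Set (ℝ → ℝ) :=
  {g | ContDiffOn ℝ (strictFloor α) g (Icc (-1) 1) ∧ lipNorm α g ≤ 1}

/-- The `ℓ_p^d` (quasi-)norm, `0 < p < ∞`. -/
def lpQuasiNorm {d : ℕ} (p : ℝ) (a : Fin d → ℝ) : ℝ := (∑ i, |a i| ^ p) ^ (1 / p)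

/-- The closed Euclidean unit ball of `ℝ^d`. -/
abbrev UnitBall (d : ℕ) : Type := Metric.closedBall (0 : EuclideanSpace ℝ (Fin d)) 1

/-- Lebesgue measure on the closed unit ball. -/
def ballMeasure (d : ℕ) : Measure (UnitBall d) := Measure.comap Subtype.val volume

/-- The class of ridge functions `x ↦ g (a · x)` on the closed unit ball with
`‖g‖_{Lip_α[-1,1]} ≤ 1` and `‖a‖_p ≤ 1`. -/
def ridgeClass (d : ℕ) (α p : ℝ) : Set (UnitBall d → ℝ) :=
  {f | ∃ g ∈ lipUnitBall α, ∃ a : Fin d → ℝ, lpQuasiNorm p a ≤ 1 ∧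
    ∀ x : UnitBall d, f x = g (∑ i, a i * x.1 i)}

/-- `L_∞` of the closed unit ball with respect to Lebesgue measure. -/
abbrev LInfty (d : ℕ) : Type := Lp ℝ ∞ (ballMeasure d)

/-- Adaptive standard information: the first `k` values of `f`, where the `(j+1)`-st sampling
point `pts j y` is a function of the vector `y` of the `j` preceding values. -/
def adaptiveInfo {X : Type*} (pts : (j : ℕ) → (Fin j → ℝ) → X) (f : X → ℝ) :
    (k : ℕ) → (Fin k → ℝ)
  | 0 => Fin.elim0
  | k + 1 => Fin.snoc (α := fun _ => ℝ) (adaptiveInfo pts f k) (f (pts k (adaptiveInfo pts f k)))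

/-- Deterministic adaptive sampling algorithms which use at most `n` function values and whose
reconstruction map sends `0` to `0`. -/
def adaptiveAlgorithms (d n : ℕ) : Set ((UnitBall d → ℝ) → LInfty d) :=
  {S | ∃ m ≤ n, ∃ pts : (j : ℕ) → (Fin j → ℝ) → UnitBall d, ∃ φ : (Fin m → ℝ) → LInfty d,
    φ 0 = 0 ∧ ∀ f, S f = φ (adaptiveInfo pts f m)}

/-- Non-adaptive sampling algorithms with linear reconstruction map which use at most `n`
function values. -/
def linearAlgorithms (d n : ℕ) : Set ((UnitBall d → ℝ) → LInfty d) :=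
  {S | ∃ m ≤ n, ∃ x : Fin m → UnitBall d, ∃ φ : (Fin m → ℝ) →ₗ[ℝ] LInfty d,
    ∀ f, S f = φ (fun i => f (x i))}

/-- The worst-case `L_∞`-error of the algorithm `S` on the class `F`. -/
def worstCaseError {d : ℕ} (F : Set (UnitBall d → ℝ)) (S : (UnitBall d → ℝ) → LInfty d) :
    ℝ≥0∞ :=
  ⨆ f ∈ F, eLpNorm (fun x => f x - S f x) ∞ (ballMeasure d)

/-- The `n`-th linear sampling number. -/
def linSamplingNumber {d : ℕ} (n : ℕ) (F : Set (UnitBall d → ℝ)) : ℝ≥0∞ :=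
  ⨅ S ∈ linearAlgorithms d n, worstCaseError F S

/-- The `n`-th adaptive sampling number. -/
def adaSamplingNumber {d : ℕ} (n : ℕ) (F : Set (UnitBall d → ℝ)) : ℝ≥0∞ :=
  ⨅ S ∈ adaptiveAlgorithms d n, worstCaseError F S

/-- The quantity `n₁ = n / (2 * binom (d+s) s)`. -/
def reducedBudget (d s n : ℕ) : ℝ := (n : ℝ) / (2 * ((d + s).choose s : ℝ))

end

/-!
*Lower bounds.* If the first `n` values of a ridge function vanish, an adaptive algorithm samples at
fixed points and returns `0`. So it is enough to find, for any `n` points of the ball, a ridge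
function of the class which vanishes at these points and is large somewhere
(`le_adaSamplingNumber`). The profile is a smooth bump of width `δ` and height `c δ ^ α` living on
`t > τ` (`exists_fooling_profile`); the direction `a` must satisfy `a · x_i ≤ τ` for all `i` and
`‖a‖₂ = τ + δ` (`exists_mul_rpow_le_adaSamplingNumber`). For `n < d` a coordinate vector will do.
For moderate `n` one takes vectors with `k` equal nonzero entries, one in each of `k` blocks of
length `q`; a point of the ball can be close to the directions of two such vectors only if these
agree in half of the blocks, hence it excludes few of them (`exists_word_forall_inner_le`). For
large `n` a volume comparison on the equatorial ball, lifted to the sphere, gives a unit vector at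
distance about `n ^ (-1/(d-1))` from all the points (`exists_unit_forall_inner_le`), which is
rescaled to `‖a‖₂ = d ^ (1/2 - 1/p)`.

*Upper bounds.* Near a point `y` of the ball the ridge function `x ↦ g (a · x)` is, up to
`2 |a · (x - y)| ^ α`, a polynomial of degree at most `s` in `x`. Such polynomials are determined by
their values at `binom (d+s) s` nodes (`finrank_polySpace_le`, `exists_lagrange_basis`), and if the
nodes are contracted towards `y` the linear reconstruction from the function values is as good as
the Taylor polynomial (`exists_local_reconstruction`). A net of `M` points with radius `r` in the
metric `sup {|a · (x - y)| : ‖a‖_p ≤ 1}` therefore gives a linear algorithm with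
`M binom (d+s) s` samples and error of order `r ^ α` (`linSamplingNumber_le_of_isDualNet`). The nets
are obtained by rounding towards zero to a lattice: this controls the sup-norm distance, and
the dual metric is controlled by interpolation between `ℓ_2` and `ℓ_∞`
(`abs_inner_le_of_abs_le`). The lattice points in the ball are counted by stars and bars, with an
`ℓ_1` bound suited to coarse lattices in `exists_supNet_sparse` (used up to `2 ^ d` net points) and
one suited to fine lattices in `exists_supNet_dense`.
-/

/-! ### The smoothness class of profiles -/

lemma strictFloor_lt {α : ℝ} (hα : 0 < α) : (strictFloor α : ℝ) < α := by
  have h1 : 0 < ⌈α⌉₊ := Nat.ceil_pos.2 hα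
  have h2 := Nat.ceil_lt_add_one hα.le
  rw [strictFloor, Nat.cast_sub h1]
  push_cast
  linarith

lemma le_strictFloor_add_one (α : ℝ) : α ≤ strictFloor α + 1 := by
  have h1 := Nat.le_ceil α
  have h2 : (⌈α⌉₊ : ℝ) ≤ (⌈α⌉₊ - 1 : ℕ) + 1 := by
    exact_mod_cast (by omega : ⌈α⌉₊ ≤ ⌈α⌉₊ - 1 + 1)
  exact h1.trans h2

lemma exists_forall_abs_iteratedDeriv_le {ψ : ℝ → ℝ} (hψ : ContDiff ℝ (⊤ : ℕ∞) ψ)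
    (hs : HasCompactSupport ψ) (N : ℕ) :
    ∃ M : ℝ, 0 < M ∧ ∀ k ≤ N, ∀ t, |iteratedDeriv k ψ t| ≤ M := by
  have key : ∀ k, ∃ M : ℝ, ∀ t, |iteratedDeriv k ψ t| ≤ M := by
    intro k
    have hc : HasCompactSupport (iteratedDeriv k ψ) := by
      induction k with
      | zero => simpa using hs
      | succ k ih => rw [iteratedDeriv_succ]; exact ih.deriv
    have hcont : Continuous (iteratedDeriv k ψ) :=
      hψ.continuous_iteratedDeriv k (by exact_mod_cast le_top)
    obtain ⟨M, hM⟩ := hc.exists_bound_of_continuous hcont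
    exact ⟨M, hM⟩
  choose M hM using key
  refine ⟨1 + ∑ k ∈ Finset.range (N + 1), |M k|, by positivity, fun k hk t => ?_⟩
  have := Finset.single_le_sum (f := fun k => |M k|) (fun _ _ => abs_nonneg _)
    (Finset.mem_range.2 (Nat.lt_succ_of_le hk))
  have h2 := (hM k t).trans (le_abs_self _)
  linarith

lemma exists_smooth_bump : ∃ ψ : ℝ → ℝ, ContDiff ℝ (⊤ : ℕ∞) ψ ∧ HasCompactSupport ψ ∧
    (∀ t ≤ 0, ψ t = 0) ∧ ψ 1 = 1 := by
  let b : ContDiffBump (1 : ℝ) := ⟨1 / 2, 1, by norm_num, by norm_num⟩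
  refine ⟨b, b.contDiff, b.hasCompactSupport, fun t ht => ?_, ?_⟩
  · apply b.zero_of_le_dist
    rw [Real.dist_eq, abs_of_nonpos (by linarith)]
    change (1 : ℝ) ≤ _
    linarith
  · apply b.one_of_mem_closedBall
    exact Metric.mem_closedBall_self (by change (0 : ℝ) ≤ 1 / 2; norm_num)

lemma mem_lipUnitBall_iff {α : ℝ} {g : ℝ → ℝ} :
    g ∈ lipUnitBall α ↔ ContDiffOn ℝ (strictFloor α) g (Icc (-1) 1) ∧
      (∀ k ≤ strictFloor α, ∀ t ∈ Icc (-1 : ℝ) 1, |profileDeriv k g t| ≤ 1) ∧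
      ∀ t ∈ Icc (-1 : ℝ) 1, ∀ u ∈ Icc (-1 : ℝ) 1,
        |profileDeriv (strictFloor α) g t - profileDeriv (strictFloor α) g u| ≤
          2 * (min 1 |t - u|) ^ (α - strictFloor α) := by
  simp only [lipUnitBall, lipNorm, cNorm, holderConst, mem_ofPred_eq, max_le_iff, iSup_le_iff,
    ENNReal.ofReal_le_one]
  refine and_congr_right fun _ => and_congr_right fun _ => ?_
  refine forall₄_congr fun t _ u _ => ?_
  constructor
  · intro h
    rcases eq_or_ne t u with rfl | hne
    · simp only [sub_self, abs_zero]
      have : (0 : ℝ) ≤ min 1 0 := by simp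
      positivity
    · have h1 := h hne
      have hpos : 0 < min 1 |t - u| := lt_min one_pos (abs_pos.2 (sub_ne_zero.2 hne))
      rwa [div_le_one (by positivity)] at h1
  · intro h hne
    have hpos : 0 < min 1 |t - u| := lt_min one_pos (abs_pos.2 (sub_ne_zero.2 hne))
    rwa [div_le_one (by positivity)]

/-- Fooling profiles: a bump of width `δ` may have height of order `δ ^ α` in the unit ball of
`Lip_α`. -/
lemma exists_fooling_profile {α : ℝ} (hα : 0 < α) : ∃ c : ℝ, 0 < c ∧ ∀ τ δ : ℝ, 0 < δ → δ ≤ 1 →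
    ∃ g ∈ lipUnitBall α, Continuous g ∧ (∀ t ≤ τ, g t = 0) ∧ g (τ + δ) = c * δ ^ α := by
  obtain ⟨ψ, hψ, hsupp, h0, h1⟩ := exists_smooth_bump
  set s := strictFloor α with hs
  obtain ⟨M, hM, hbd⟩ := exists_forall_abs_iteratedDeriv_le hψ hsupp (s + 1)
  have hsα := strictFloor_lt hα
  have hαs := le_strictFloor_add_one α
  rw [← hs] at hsα hαs
  refine ⟨1 / M, by positivity, fun τ δ hδ hδ1 => ?_⟩
  let g : ℝ → ℝ := fun t => (1 / M * δ ^ α) * ψ (δ⁻¹ * (t - τ))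
  have hg : ContDiff ℝ (⊤ : ℕ∞) g := by
    exact contDiff_const.mul (hψ.comp (contDiff_const.mul (contDiff_id.sub contDiff_const)))
  have hder : ∀ k t, iteratedDeriv k g t =
      (1 / M * δ ^ α) * (δ⁻¹ ^ k * iteratedDeriv k ψ (δ⁻¹ * (t - τ))) := by
    intro k t
    have hψk : ContDiff ℝ k ψ := hψ.of_le (by exact_mod_cast le_top)
    have e1 := iteratedDeriv_const_mul_field (n := k) (x := t) (1 / M * δ ^ α)
      (fun t => ψ (δ⁻¹ * (t - τ)))
    have e2 := congrFun (iteratedDeriv_comp_sub_const k (fun u => ψ (δ⁻¹ * u)) τ) t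
    have e3 := congrFun (iteratedDeriv_comp_const_mul hψk δ⁻¹) (t - τ)
    change iteratedDeriv k (fun t => (1 / M * δ ^ α) * ψ (δ⁻¹ * (t - τ))) t = _
    rw [e1, e2, e3]
  have hprof : ∀ k, ∀ t ∈ Icc (-1 : ℝ) 1, profileDeriv k g t = iteratedDeriv k g t := by
    intro k t ht
    exact iteratedDerivWithin_eq_iteratedDeriv (uniqueDiffOn_Icc (by norm_num))
      (hg.of_le (by exact_mod_cast le_top)).contDiffAt ht
  refine ⟨g, mem_lipUnitBall_iff.2 ⟨(hg.of_le (by exact_mod_cast le_top)).contDiffOn, ?_, ?_⟩,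
    hg.continuous, fun t ht => ?_, ?_⟩
  · intro k hk t ht
    rw [← hs] at hk
    rw [hprof k t ht, hder, ← mul_assoc, abs_mul]
    have hb := hbd k (by omega) (δ⁻¹ * (t - τ))
    have hA : δ ^ α * δ⁻¹ ^ k ≤ 1 := by
      rw [inv_pow, ← div_eq_mul_inv, div_le_one (by positivity), ← Real.rpow_natCast]
      apply Real.rpow_le_rpow_of_exponent_ge hδ hδ1
      have : (k : ℝ) ≤ s := by exact_mod_cast hk
      linarith
    rw [abs_of_pos (by positivity)]
    calc 1 / M * δ ^ α * δ⁻¹ ^ k * |iteratedDeriv k ψ (δ⁻¹ * (t - τ))|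
        ≤ 1 / M * δ ^ α * δ⁻¹ ^ k * M := by gcongr
      _ = δ ^ α * δ⁻¹ ^ k := by field_simp
      _ ≤ 1 := hA
  · intro t ht u hu
    rw [hprof _ t ht, hprof _ u hu, hder, hder, ← hs, ← mul_sub, ← mul_sub, abs_mul,
      abs_mul (δ⁻¹ ^ s)]
    set x := δ⁻¹ * (t - τ)
    set y := δ⁻¹ * (u - τ)
    have hxy : |x - y| = |t - u| / δ := by
      have : x - y = (t - u) / δ := by simp only [x, y]; field_simp; ring
      rw [this, abs_div, abs_of_pos hδ]
    have hd1 : |iteratedDeriv s ψ x - iteratedDeriv s ψ y| ≤ 2 * M := by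
      have h1 := hbd s (by omega) x
      have h2 := hbd s (by omega) y
      have := abs_sub (iteratedDeriv s ψ x) (iteratedDeriv s ψ y)
      linarith
    have hd2 : |iteratedDeriv s ψ x - iteratedDeriv s ψ y| ≤ M * |x - y| := by
      have hdiff : Differentiable ℝ (iteratedDeriv s ψ) :=
        hψ.differentiable_iteratedDeriv s (by exact_mod_cast WithTop.coe_lt_top s)
      have := convex_univ.norm_image_sub_le_of_norm_deriv_le (f := iteratedDeriv s ψ) (C := M)
        (fun z _ => hdiff z) (fun z _ => by
          rw [← iteratedDeriv_succ]; exact hbd (s + 1) le_rfl z) (mem_univ y) (mem_univ x)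
      simpa using this
    set β := α - s with hβ
    have hβ0 : 0 < β := by linarith
    have hβ1 : β ≤ 1 := by linarith
    set m := min 1 (|t - u| / δ) with hm
    have hm0 : 0 ≤ m := le_min zero_le_one (by positivity)
    have hd3 : |iteratedDeriv s ψ x - iteratedDeriv s ψ y| ≤ 2 * M * m ^ β := by
      have hm1 : m ≤ m ^ β := by
        rcases hm0.eq_or_lt with h | h
        · rw [← h]; exact Real.rpow_nonneg le_rfl _
        · have := Real.rpow_le_rpow_of_exponent_ge h (min_le_left _ _) hβ1
          rwa [Real.rpow_one] at this
      have : |iteratedDeriv s ψ x - iteratedDeriv s ψ y| ≤ 2 * M * m := by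
        rcases min_cases 1 (|t - u| / δ) with ⟨h, _⟩ | ⟨h, _⟩
        · rw [hm, h]; linarith
        · rw [hm, h, ← hxy]
          have : 0 ≤ M * |x - y| := by positivity
          linarith
      exact this.trans (by gcongr)
    have hδβ : δ ^ α * δ⁻¹ ^ s = δ ^ β := by
      rw [hβ, Real.rpow_sub hδ, Real.rpow_natCast, inv_pow, div_eq_mul_inv]
    have hmin : δ * m ≤ min 1 |t - u| := by
      apply le_min
      · calc δ * m ≤ 1 * 1 := by
              apply mul_le_mul hδ1 (min_le_left _ _) hm0 zero_le_one
          _ = 1 := one_mul 1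
      · calc δ * m ≤ δ * (|t - u| / δ) := by
              gcongr; exact min_le_right _ _
          _ = |t - u| := by field_simp
    calc |1 / M * δ ^ α| * (|δ⁻¹ ^ s| * |iteratedDeriv s ψ x - iteratedDeriv s ψ y|)
        = 1 / M * (δ ^ α * δ⁻¹ ^ s) * |iteratedDeriv s ψ x - iteratedDeriv s ψ y| := by
          rw [abs_of_pos (by positivity), abs_of_pos (by positivity : 0 < δ⁻¹ ^ s)]; ring
      _ ≤ 1 / M * δ ^ β * (2 * M * m ^ β) := by rw [hδβ]; gcongr
      _ = 2 * (δ ^ β * m ^ β) := by field_simp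
      _ = 2 * (δ * m) ^ β := by rw [Real.mul_rpow hδ.le hm0]
      _ ≤ 2 * (min 1 |t - u|) ^ β := by gcongr
  · have : δ⁻¹ * (t - τ) ≤ 0 := mul_nonpos_of_nonneg_of_nonpos (by positivity) (by linarith)
    simp [g, h0 _ this]
  · change 1 / M * δ ^ α * ψ (δ⁻¹ * (τ + δ - τ)) = _
    rw [add_sub_cancel_left, inv_mul_cancel₀ hδ.ne', h1, mul_one]

/-! ### Lower bounds from vanishing information -/

instance ballMeasure_isOpenPosMeasure (d : ℕ) : (ballMeasure d).IsOpenPosMeasure := by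
  constructor
  rintro U hU ⟨x, hx⟩ h0
  obtain ⟨V, hV, rfl⟩ := hU
  have hemb : MeasurableEmbedding (Subtype.val : UnitBall d → EuclideanSpace ℝ (Fin d)) :=
    MeasurableEmbedding.subtype_coe Metric.isClosed_closedBall.measurableSet
  rw [ballMeasure, hemb.comap_apply, Subtype.image_preimage_coe] at h0
  have hxcl : x.1 ∈ closure (Metric.ball (0 : EuclideanSpace ℝ (Fin d)) 1) := by
    rw [closure_ball _ one_ne_zero]; exact x.2
  obtain ⟨y, hyV, hyb⟩ := mem_closure_iff.1 hxcl V hV hx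
  have hpos : 0 < volume (V ∩ Metric.ball (0 : EuclideanSpace ℝ (Fin d)) 1) :=
    (hV.inter Metric.isOpen_ball).measure_pos _ ⟨y, hyV, hyb⟩
  refine absurd h0 (ne_of_gt (hpos.trans_le (measure_mono ?_)))
  exact fun z hz => ⟨Metric.ball_subset_closedBall hz.2, hz.1⟩

lemma ofReal_abs_le_eLpNorm_top {d : ℕ} {f : UnitBall d → ℝ} (hf : Continuous f)
    (x : UnitBall d) : ENNReal.ofReal |f x| ≤ eLpNorm f ∞ (ballMeasure d) := by
  rw [eLpNorm_exponent_top]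
  have hae := enorm_ae_le_eLpNormEssSup f (ballMeasure d)
  have hd := Measure.dense_of_ae hae
  have hcl : IsClosed {y | ‖f y‖ₑ ≤ eLpNormEssSup f (ballMeasure d)} :=
    isClosed_le hf.enorm continuous_const
  have : x ∈ {y | ‖f y‖ₑ ≤ eLpNormEssSup f (ballMeasure d)} := by
    rw [← hcl.closure_eq]; exact hd x
  simpa [Real.enorm_eq_ofReal_abs] using this

lemma adaptiveInfo_eq_zero {X : Type*} (pts : (j : ℕ) → (Fin j → ℝ) → X) (f : X → ℝ) (m : ℕ)
    (h : ∀ j < m, f (pts j 0) = 0) : adaptiveInfo pts f m = 0 := by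
  induction m with
  | zero => exact Subsingleton.elim _ _
  | succ m ih =>
    have ih' := ih fun j hj => h j (hj.trans m.lt_succ_self)
    simp only [adaptiveInfo]
    rw [ih', h m m.lt_succ_self]
    ext i
    refine Fin.lastCases ?_ (fun i => ?_) i <;> simp

/-- On data that vanish, an adaptive algorithm samples at fixed points and returns `0`; it
therefore errs at least as much as a function of the class vanishing at these points is large. -/
lemma le_adaSamplingNumber {d n : ℕ} {F : Set (UnitBall d → ℝ)} {e : ℝ}
    (h : ∀ x : Fin n → UnitBall d, ∃ f ∈ F, Continuous f ∧ (∀ i, f (x i) = 0) ∧ ∃ z, e ≤ |f z|) :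
    ENNReal.ofReal e ≤ adaSamplingNumber n F := by
  refine le_iInf₂ fun S hS => ?_
  obtain ⟨m, hm, pts, φ, hφ, hS⟩ := hS
  obtain ⟨f, hf, hc, h0, z, hz⟩ := h fun i => pts i 0
  have hSf : S f = 0 := by
    rw [hS, adaptiveInfo_eq_zero pts f m fun j hj => h0 ⟨j, hj.trans_le hm⟩, hφ]
  refine le_trans ?_ (le_iSup₂ f hf)
  have hcong : eLpNorm (fun x => f x - S f x) ∞ (ballMeasure d) = eLpNorm f ∞ (ballMeasure d) := by
    simp [hSf]
  rw [hcong]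
  exact (ENNReal.ofReal_le_ofReal hz).trans (ofReal_abs_le_eLpNorm_top hc z)

lemma sum_mul_eq_inner {d : ℕ} (a x : EuclideanSpace ℝ (Fin d)) :
    ∑ i, a i * x i = inner ℝ a x := by
  rw [EuclideanSpace.inner_eq_star_dotProduct]
  simp [dotProduct, mul_comm]

/-- If for any `n` points there is an admissible direction `a` which has inner product at most
`τ` with all of them while `‖a‖₂ = τ + δ`, then `n` samples cannot do better than `δ ^ α`. -/
lemma exists_mul_rpow_le_adaSamplingNumber {α : ℝ} (hα : 0 < α) (p : ℝ) :
    ∃ c : ℝ, 0 < c ∧ ∀ (d n : ℕ) (τ δ : ℝ), 0 < δ → δ ≤ 1 →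
      (∀ x : Fin n → UnitBall d, ∃ a : EuclideanSpace ℝ (Fin d), lpQuasiNorm p a ≤ 1 ∧
        0 < ‖a‖ ∧ ‖a‖ = τ + δ ∧ ∀ i, inner ℝ a (x i).1 ≤ τ) →
      ENNReal.ofReal (c * δ ^ α) ≤ adaSamplingNumber n (ridgeClass d α p) := by
  obtain ⟨c, hc, H⟩ := exists_fooling_profile hα
  refine ⟨c, hc, fun d n τ δ hδ hδ1 h => le_adaSamplingNumber fun x => ?_⟩
  obtain ⟨a, hap, ha0, han, hax⟩ := h x
  obtain ⟨g, hg, hgc, hg0, hg1⟩ := H τ δ hδ hδ1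
  refine ⟨fun x => g (inner ℝ a x.1), ⟨g, hg, a, hap, fun x => by rw [sum_mul_eq_inner]⟩,
    by fun_prop, fun i => hg0 _ (hax i), ?_⟩
  refine ⟨⟨‖a‖⁻¹ • a, ?_⟩, ?_⟩
  · rw [mem_closedBall_zero_iff, norm_smul, norm_inv, norm_norm, inv_mul_cancel₀ ha0.ne']
  · have : inner ℝ a (‖a‖⁻¹ • a) = τ + δ := by
      rw [real_inner_smul_right, real_inner_self_eq_norm_sq, ← han]; field_simp
    simp only [this, hg1]
    exact le_abs_self _

/-! ### Directions avoiding finitely many points -/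

lemma lpQuasiNorm_le_one_of_sum_le {d : ℕ} {p : ℝ} (hp : 0 < p) {a : Fin d → ℝ}
    (h : ∑ i, |a i| ^ p ≤ 1) : lpQuasiNorm p a ≤ 1 :=
  Real.rpow_le_one (by positivity) h (by positivity)

lemma sum_le_one_of_lpQuasiNorm_le_one {d : ℕ} {p : ℝ} (hp : 0 < p) {a : Fin d → ℝ}
    (h : lpQuasiNorm p a ≤ 1) : ∑ i, |a i| ^ p ≤ 1 := by
  by_contra! hlt
  exact absurd h (not_le.2 (Real.one_lt_rpow hlt (by positivity)))

/-- A point of the unit ball has at most one coordinate above `3 / 4`. -/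
lemma exists_coord_le_of_lt {d n : ℕ} (hn : n < d) (x : Fin n → UnitBall d) :
    ∃ j, ∀ i, (x i).1 j ≤ 3 / 4 := by
  by_contra! h
  choose f hf using h
  obtain ⟨j, j', hne, he⟩ := Fintype.exists_ne_map_eq_of_card_lt f (by simpa using hn)
  have h1 := hf j
  have h2 := hf j'
  rw [← he] at h2
  have hx : ‖(x (f j)).1‖ ^ 2 ≤ 1 := by
    have := mem_closedBall_zero_iff.1 (x (f j)).2
    exact pow_le_one₀ (norm_nonneg _) this
  rw [EuclideanSpace.real_norm_sq_eq] at hx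
  have := Finset.add_le_sum (f := fun i => (x (f j)).1 i ^ 2) (fun i _ => sq_nonneg _)
    (Finset.mem_univ j) (Finset.mem_univ j') hne
  simp only at this
  nlinarith

lemma lower_bound_few_samples {α p : ℝ} (hα : 0 < α) (hp : 0 < p) :
    ∃ c : ℝ, 0 < c ∧ ∀ d n : ℕ, n < d →
      ENNReal.ofReal c ≤ adaSamplingNumber n (ridgeClass d α p) := by
  obtain ⟨c, hc, H⟩ := exists_mul_rpow_le_adaSamplingNumber hα p
  refine ⟨c * (1 / 4) ^ α, by positivity, fun d n hn => ?_⟩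
  refine H d n (3 / 4) (1 / 4) (by norm_num) (by norm_num) fun x => ?_
  obtain ⟨j, hj⟩ := exists_coord_le_of_lt hn x
  refine ⟨EuclideanSpace.single j 1, lpQuasiNorm_le_one_of_sum_le hp ?_, by simp, ?_, fun i => ?_⟩
  · rw [Finset.sum_eq_single j]
    · simp
    · intro i _ hi
      simp [hi, hp.ne']
    · simp
  · rw [PiLp.norm_single]; norm_num
  · simpa [EuclideanSpace.inner_single_left] using hj i

/-- A volume comparison in dimension `k` gives a point of the unit ball at distance at least `ε`
from `n` given points as soon as `n ε ^ k < 1`. -/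
lemma exists_mem_closedBall_forall_le_dist {k n : ℕ}
    (y : Fin n → EuclideanSpace ℝ (Fin k)) {ε : ℝ} (hε : 0 < ε) (h : n * ε ^ k < 1) :
    ∃ v ∈ Metric.closedBall (0 : EuclideanSpace ℝ (Fin k)) 1, ∀ i, ε ≤ dist v (y i) := by
  by_contra! hcon
  have hsub : Metric.ball (0 : EuclideanSpace ℝ (Fin k)) 1 ⊆ ⋃ i, Metric.ball (y i) ε := by
    intro v hv
    obtain ⟨i, hi⟩ := hcon v (Metric.ball_subset_closedBall hv)
    exact mem_iUnion.2 ⟨i, hi⟩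
  set V := volume (Metric.ball (0 : EuclideanSpace ℝ (Fin k)) 1) with hV
  have hV0 : V ≠ 0 := (Metric.measure_ball_pos _ _ one_pos).ne'
  have hVt : V ≠ ∞ := measure_ball_lt_top.ne
  have h1 : V ≤ ENNReal.ofReal (n * ε ^ k) * V := by
    calc V ≤ volume (⋃ i, Metric.ball (y i) ε) := measure_mono hsub
      _ ≤ ∑ i, volume (Metric.ball (y i) ε) := measure_iUnion_fintype_le _ _
      _ = ∑ _i : Fin n, ENNReal.ofReal (ε ^ k) * V := by
          refine Finset.sum_congr rfl fun i _ => ?_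
          rw [Measure.addHaar_ball_of_pos _ _ hε, finrank_euclideanSpace_fin]
      _ = ENNReal.ofReal (n * ε ^ k) * V := by
          rw [Finset.sum_const, Finset.card_univ, Fintype.card_fin, nsmul_eq_mul,
            ENNReal.ofReal_mul (by positivity), ENNReal.ofReal_natCast, mul_assoc]
  have h2 : ENNReal.ofReal (n * ε ^ k) * V < 1 * V := by
    rw [ENNReal.mul_lt_mul_iff_left hV0 hVt]
    exact ENNReal.ofReal_lt_one.2 h
  rw [one_mul] at h2
  exact absurd h1 (not_le.2 h2)

/-- A unit vector on the upper half sphere over a point of the equatorial ball which is far from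
the projections of the given points. -/
lemma exists_unit_forall_inner_le {k n : ℕ}
    (x : Fin n → UnitBall (k + 1)) {ε : ℝ} (hε : 0 < ε) (h : n * ε ^ k < 1) :
    ∃ u : EuclideanSpace ℝ (Fin (k + 1)), ‖u‖ = 1 ∧ ∀ i, inner ℝ u (x i).1 ≤ 1 - ε ^ 2 / 2 := by
  obtain ⟨v, hv, hvx⟩ := exists_mem_closedBall_forall_le_dist
    (fun i => WithLp.toLp 2 fun j => (x i).1 j.succ) hε h
  have hv1 : ‖v‖ ^ 2 ≤ 1 := pow_le_one₀ (norm_nonneg _) (mem_closedBall_zero_iff.1 hv)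
  let u : EuclideanSpace ℝ (Fin (k + 1)) :=
    WithLp.toLp 2 (Fin.cons (√(1 - ‖v‖ ^ 2)) v)
  have hu : ‖u‖ ^ 2 = 1 := by
    rw [EuclideanSpace.real_norm_sq_eq, Fin.sum_univ_succ]
    simp only [u, Fin.cons_zero, Fin.cons_succ]
    rw [Real.sq_sqrt (by linarith), ← EuclideanSpace.real_norm_sq_eq]
    ring
  refine ⟨u, by nlinarith [norm_nonneg u], fun i => ?_⟩
  have h1 : ε ^ 2 ≤ ‖u - (x i).1‖ ^ 2 := by
    have h2 : ε ^ 2 ≤ dist v (WithLp.toLp 2 fun j => (x i).1 j.succ) ^ 2 := by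
      gcongr; exact hvx i
    refine h2.trans ?_
    rw [dist_eq_norm, EuclideanSpace.real_norm_sq_eq, EuclideanSpace.real_norm_sq_eq,
      Fin.sum_univ_succ]
    simp only [u, PiLp.sub_apply, Fin.cons_zero, Fin.cons_succ]
    have := sq_nonneg (√(1 - ‖v‖ ^ 2) - (x i).1 0)
    linarith
  have h3 : ‖(x i).1‖ ^ 2 ≤ 1 :=
    pow_le_one₀ (norm_nonneg _) (mem_closedBall_zero_iff.1 (x i).2)
  rw [norm_sub_sq_real, hu] at h1
  linarith

/-- By the power mean inequality a vector of Euclidean norm `d ^ (1/2 - 1/p)` lies in the unit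
ball of `ℓ_p^d`. -/
lemma lpQuasiNorm_smul_le_one {d : ℕ} (hd : 0 < d) {p : ℝ} (hp : 0 < p) (hp2 : p ≤ 2)
    {u : EuclideanSpace ℝ (Fin d)} (hu : ‖u‖ = 1) :
    lpQuasiNorm p (((d : ℝ) ^ (1 / 2 - 1 / p : ℝ)) • u) ≤ 1 := by
  apply lpQuasiNorm_le_one_of_sum_le hp
  have hd' : (0 : ℝ) < d := by exact_mod_cast hd
  set r := (d : ℝ) ^ (1 / 2 - 1 / p : ℝ) with hr
  have hr0 : 0 < r := by positivity
  have hpow := Real.rpow_sum_le_const_mul_sum_rpow_of_nonneg (s := (Finset.univ : Finset (Fin d)))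
    (f := fun i => |r • u i| ^ p) (p := 2 / p) (by rw [le_div_iff₀ hp]; linarith)
    (fun i _ => by positivity)
  have h1 : ∑ i, (|r • u i| ^ p) ^ (2 / p) = r ^ 2 := by
    have : ∀ i, (|r • u i| ^ p) ^ (2 / p) = r ^ 2 * (u i) ^ 2 := by
      intro i
      rw [← Real.rpow_mul (abs_nonneg _), mul_div_cancel₀ _ hp.ne', Real.rpow_two, sq_abs,
        smul_eq_mul, mul_pow]
    simp_rw [this]
    rw [← Finset.mul_sum, ← EuclideanSpace.real_norm_sq_eq, hu]
    ring
  rw [h1, Finset.card_univ, Fintype.card_fin] at hpow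
  have h2 : (d : ℝ) ^ (2 / p - 1) * r ^ 2 = 1 := by
    rw [hr, ← Real.rpow_natCast, ← Real.rpow_mul hd'.le, ← Real.rpow_add hd']
    have : 2 / p - 1 + (1 / 2 - 1 / p) * ((2 : ℕ) : ℝ) = 0 := by
      push_cast; field_simp; ring
    rw [this, Real.rpow_zero]
  rw [h2] at hpow
  by_contra! hlt
  exact absurd hpow (not_le.2 (Real.one_lt_rpow hlt (by positivity)))

/-- The lower bound from directions spread over the whole sphere. -/
lemma lower_bound_sphere {α p : ℝ} (hα : 0 < α) (hp : 0 < p) (hp2 : p ≤ 2) :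
    ∃ c : ℝ, 0 < c ∧ ∀ d n : ℕ, 2 ≤ d → 1 ≤ n →
      ENNReal.ofReal (c * ((n : ℝ) ^ (-2 * α / ((d : ℝ) - 1)) *
        (d : ℝ) ^ (-α * (1 / p - 1 / 2)))) ≤ adaSamplingNumber n (ridgeClass d α p) := by
  obtain ⟨c, hc, H⟩ := exists_mul_rpow_le_adaSamplingNumber hα p
  refine ⟨c * (1 / 8) ^ α, by positivity, fun d n hd hn => ?_⟩
  obtain ⟨k, rfl⟩ : ∃ k, d = k + 1 := ⟨d - 1, by omega⟩
  have hk : 0 < k := by omega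
  have hk' : (0 : ℝ) < k := by exact_mod_cast hk
  have hn' : (1 : ℝ) ≤ n := by exact_mod_cast hn
  have hn0 : (0 : ℝ) < n := by linarith
  have hd1 : (1 : ℝ) ≤ ((k + 1 : ℕ) : ℝ) := by exact_mod_cast Nat.le_add_left 1 k
  -- With this `ε` the volume condition reads `n ε ^ k = 1 / 2 < 1`.
  set ε : ℝ := (2 * n : ℝ) ^ (-(1 / k : ℝ)) with hε
  have hε0 : 0 < ε := by positivity
  have hε1 : ε ≤ 1 := by
    apply Real.rpow_le_one_of_one_le_of_nonpos (by linarith)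
    rw [neg_nonpos]; positivity
  have hεk : n * ε ^ k < 1 := by
    rw [hε, ← Real.rpow_natCast, ← Real.rpow_mul (by positivity)]
    have : -(1 / k : ℝ) * (k : ℕ) = -1 := by field_simp
    rw [this, Real.rpow_neg_one]
    field_simp
    norm_num
  set r : ℝ := ((k + 1 : ℕ) : ℝ) ^ (1 / 2 - 1 / p : ℝ) with hr
  have hr0 : 0 < r := by positivity
  have hr1 : r ≤ 1 := by
    apply Real.rpow_le_one_of_one_le_of_nonpos hd1
    rw [sub_nonpos]
    exact one_div_le_one_div_of_le hp hp2
  have hδ1 : ε ^ 2 / 2 * r ≤ 1 := by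
    have : ε ^ 2 ≤ 1 := pow_le_one₀ hε0.le hε1
    nlinarith
  refine le_trans (ENNReal.ofReal_le_ofReal ?_)
    (H (k + 1) n ((1 - ε ^ 2 / 2) * r) (ε ^ 2 / 2 * r) (by positivity) hδ1 fun x => ?_)
  · have h1 : (1 / 8 : ℝ) * (n : ℝ) ^ (-2 / k : ℝ) ≤ ε ^ 2 / 2 := by
      have e1 : ε ^ 2 = (2 : ℝ) ^ (-2 / k : ℝ) * (n : ℝ) ^ (-2 / k : ℝ) := by
        rw [hε, ← Real.rpow_natCast, ← Real.rpow_mul (by positivity),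
          Real.mul_rpow (by norm_num) hn0.le]
        have : -(1 / k : ℝ) * (2 : ℕ) = -2 / k := by push_cast; ring
        rw [this]
      have e2 : (2 : ℝ) ^ (-2 : ℝ) ≤ (2 : ℝ) ^ (-2 / k : ℝ) := by
        apply Real.rpow_le_rpow_of_exponent_le (by norm_num)
        rw [le_div_iff₀ hk']
        have : (1 : ℝ) ≤ k := by exact_mod_cast hk
        linarith
      have e3 : (2 : ℝ) ^ (-2 : ℝ) = 1 / 4 := by
        rw [Real.rpow_neg (by norm_num), Real.rpow_two]; norm_num
      have : (0 : ℝ) < (n : ℝ) ^ (-2 / k : ℝ) := by positivity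
      rw [e1]
      nlinarith
    have h2 : (n : ℝ) ^ (-2 * α / (((k + 1 : ℕ) : ℝ) - 1)) = ((n : ℝ) ^ (-2 / k : ℝ)) ^ α := by
      rw [← Real.rpow_mul hn0.le]
      congr 1
      push_cast
      ring
    have h3 : ((k + 1 : ℕ) : ℝ) ^ (-α * (1 / p - 1 / 2)) = r ^ α := by
      rw [hr, ← Real.rpow_mul (by positivity)]
      congr 1
      ring
    rw [h2, h3, mul_assoc, ← mul_assoc _ _ (r ^ α),
      ← Real.mul_rpow (by norm_num) (by positivity), ← Real.mul_rpow (by positivity) hr0.le]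
    gcongr
  · obtain ⟨u, hu, hux⟩ := exists_unit_forall_inner_le x hε0 hεk
    refine ⟨r • u, lpQuasiNorm_smul_le_one (Nat.succ_pos k) hp hp2 hu, ?_, ?_, fun i => ?_⟩
    · rw [norm_smul, hu, mul_one]; exact norm_pos_iff.2 hr0.ne'
    · rw [norm_smul, hu, mul_one, Real.norm_of_nonneg hr0.le]; ring
    · rw [real_inner_smul_left, mul_comm]
      gcongr
      exact hux i

/-! ### Sparse directions -/

/-- A family of words of length `k` over an alphabet of `q` letters, any two of which agree in at
least half of the places, is small. -/
lemma card_le_of_pairwise_agree {k q : ℕ} (hq : 0 < q) (E : Finset (Fin k → Fin q))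
    (h : ∀ w ∈ E, ∀ w' ∈ E, k ≤ 2 * (Finset.univ.filter fun j => w j = w' j).card) :
    E.card ≤ 2 ^ k * q ^ (k / 2) := by
  classical
  rcases E.eq_empty_or_nonempty with rfl | ⟨w₀, hw₀⟩
  · simp
  let P : Finset (Fin k) → Finset (Fin k → Fin q) := fun T =>
    Fintype.piFinset fun j => if j ∈ T then {w₀ j} else Finset.univ
  have hP : ∀ T, k ≤ 2 * T.card → (P T).card ≤ q ^ (k / 2) := by
    intro T hT
    have h1 : (P T).card = q ^ (Tᶜ).card := by
      rw [Fintype.card_piFinset]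
      rw [← Finset.prod_mul_prod_compl T, Finset.prod_eq_one, one_mul,
        Finset.prod_congr rfl (g := fun _ => q), Finset.prod_const]
      · intro j hj
        rw [Finset.mem_compl] at hj
        simp [hj]
      · intro j hj
        simp [hj]
    rw [h1, Finset.card_compl, Fintype.card_fin]
    exact Nat.pow_le_pow_right hq (by omega)
  have hsub : E ⊆ (Finset.univ.filter fun T : Finset (Fin k) => k ≤ 2 * T.card).biUnion P := by
    intro w hw
    rw [Finset.mem_biUnion]
    refine ⟨Finset.univ.filter fun j => w j = w₀ j, by simpa using h w hw w₀ hw₀, ?_⟩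
    rw [Fintype.mem_piFinset]
    intro j
    by_cases hj : w j = w₀ j <;> simp [hj]
  calc E.card ≤ _ := Finset.card_le_card hsub
    _ ≤ ∑ T ∈ Finset.univ.filter fun T : Finset (Fin k) => k ≤ 2 * T.card, (P T).card :=
        Finset.card_biUnion_le
    _ ≤ ∑ T ∈ Finset.univ.filter fun T : Finset (Fin k) => k ≤ 2 * T.card, q ^ (k / 2) :=
        Finset.sum_le_sum fun T hT => hP T (Finset.mem_filter.1 hT).2
    _ ≤ 2 ^ k * q ^ (k / 2) := by
        rw [Finset.sum_const, smul_eq_mul]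
        gcongr
        exact (Finset.card_le_univ _).trans (by simp)

/-- The vector with entries `t` on `S` and `0` elsewhere. -/
noncomputable def flatVector {d : ℕ} (t : ℝ) (S : Finset (Fin d)) : EuclideanSpace ℝ (Fin d) :=
  WithLp.toLp 2 fun i => if i ∈ S then t else 0

lemma inner_flatVector {d : ℕ} (t : ℝ) (S T : Finset (Fin d)) :
    inner ℝ (flatVector t S) (flatVector t T) = (S ∩ T).card * t ^ 2 := by
  rw [← sum_mul_eq_inner]
  simp only [flatVector]
  have : ∀ i, (if i ∈ S then t else 0) * (if i ∈ T then t else 0) =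
      if i ∈ S ∩ T then t ^ 2 else 0 := by
    intro i
    by_cases h1 : i ∈ S <;> by_cases h2 : i ∈ T <;> simp [h1, h2, sq]
  simp_rw [this]
  rw [Finset.sum_ite_mem, Finset.univ_inter, Finset.sum_const, nsmul_eq_mul]

lemma sum_abs_rpow_flatVector {d : ℕ} {p t : ℝ} (hp : 0 < p) (ht : 0 ≤ t) (S : Finset (Fin d)) :
    ∑ i, |flatVector t S i| ^ p = S.card * t ^ p := by
  simp only [flatVector]
  have : ∀ i, |if i ∈ S then t else 0| ^ p = if i ∈ S then t ^ p else 0 := by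
    intro i
    by_cases h1 : i ∈ S <;> simp [h1, abs_of_nonneg ht, hp.ne']
  simp_rw [this]
  rw [Finset.sum_ite_mem, Finset.univ_inter, Finset.sum_const, nsmul_eq_mul]

/-- The support attached to a word `w`: one element of each of `k` blocks of length `q`. -/
def wordSupport {d k q : ℕ} (h : k * q ≤ d) (w : Fin k → Fin q) : Finset (Fin d) :=
  Finset.univ.image fun j => Fin.castLE h (finProdFinEquiv (j, w j))

lemma card_wordSupport {d k q : ℕ} (h : k * q ≤ d) (w : Fin k → Fin q) :
    (wordSupport h w).card = k := by
  rw [wordSupport, Finset.card_image_of_injective, Finset.card_univ, Fintype.card_fin]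
  intro j j' hj
  have := finProdFinEquiv.injective (Fin.castLE_injective h hj)
  exact (Prod.ext_iff.1 this).1

lemma card_wordSupport_inter_le {d k q : ℕ} (h : k * q ≤ d) (w w' : Fin k → Fin q) :
    (wordSupport h w ∩ wordSupport h w').card ≤
      (Finset.univ.filter fun j => w j = w' j).card := by
  refine le_trans (Finset.card_le_card (t := (Finset.univ.filter fun j => w j = w' j).image
    fun j => Fin.castLE h (finProdFinEquiv (j, w j))) ?_) Finset.card_image_le
  intro i hi
  simp only [wordSupport, Finset.mem_inter, Finset.mem_image, Finset.mem_univ, true_and] at hi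
  obtain ⟨⟨j, rfl⟩, ⟨j', hj'⟩⟩ := hi
  have := finProdFinEquiv.injective (Fin.castLE_injective h hj')
  obtain ⟨h1, h2⟩ := Prod.ext_iff.1 this
  simp only at h1 h2
  subst h1
  exact Finset.mem_image.2 ⟨j', by simp [h2], rfl⟩

/-- A point of the unit ball which is close to the direction of two flat vectors forces their
supports to overlap in more than half of the places; so `n` points cannot be close to all of
the directions given by words. -/
lemma exists_word_forall_inner_le {d k q n : ℕ} (hk : 0 < k) (hq : 0 < q) (h : k * q ≤ d)
    (hn : n * (2 ^ k * q ^ (k / 2)) < q ^ k) {t : ℝ} (ht : 0 < t) (x : Fin n → UnitBall d) :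
    ∃ w : Fin k → Fin q, ∀ i,
      inner ℝ (flatVector t (wordSupport h w)) (x i).1 ≤ 9 / 10 * (√k * t) := by
  classical
  by_contra! hcon
  have hk' : (0 : ℝ) < k := by exact_mod_cast hk
  let E : Fin n → Finset (Fin k → Fin q) := fun i => Finset.univ.filter fun w =>
    9 / 10 * (√k * t) < inner ℝ (flatVector t (wordSupport h w)) (x i).1
  have hE : ∀ i, (E i).card ≤ 2 ^ k * q ^ (k / 2) := by
    intro i
    refine card_le_of_pairwise_agree hq _ fun w hw w' hw' => ?_
    have h1 := (Finset.mem_filter.1 hw).2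
    have h2 := (Finset.mem_filter.1 hw').2
    set a := flatVector t (wordSupport h w) with ha
    set b := flatVector t (wordSupport h w') with hb
    have hx : ‖(x i).1‖ ≤ 1 := mem_closedBall_zero_iff.1 (x i).2
    have h3 : 9 / 5 * (√k * t) ≤ ‖a + b‖ := by
      calc 9 / 5 * (√k * t) ≤ inner ℝ (a + b) (x i).1 := by rw [inner_add_left]; linarith
        _ ≤ ‖a + b‖ * ‖(x i).1‖ := real_inner_le_norm _ _
        _ ≤ ‖a + b‖ := mul_le_of_le_one_right (norm_nonneg _) hx
    have h4 : (9 / 5 * (√k * t)) ^ 2 ≤ ‖a + b‖ ^ 2 := by gcongr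
    have haa : ‖a‖ ^ 2 = k * t ^ 2 := by
      rw [← real_inner_self_eq_norm_sq, ha, inner_flatVector, Finset.inter_self,
        card_wordSupport]
    have hbb : ‖b‖ ^ 2 = k * t ^ 2 := by
      rw [← real_inner_self_eq_norm_sq, hb, inner_flatVector, Finset.inter_self,
        card_wordSupport]
    rw [norm_add_sq_real, haa, hbb, ha, hb, inner_flatVector, mul_pow, mul_pow,
      Real.sq_sqrt hk'.le] at h4
    have h5 := card_wordSupport_inter_le h w w'
    set A := (Finset.univ.filter fun j => w j = w' j).card
    have h6 : ((wordSupport h w ∩ wordSupport h w').card : ℝ) ≤ A := by exact_mod_cast h5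
    have ht2 : 0 < t ^ 2 := by positivity
    have h7 : (k : ℝ) ≤ 2 * A := by
      have : (k : ℝ) * t ^ 2 ≤ 2 * A * t ^ 2 := by nlinarith
      exact le_of_mul_le_mul_right this ht2
    exact_mod_cast h7
  have hcov : (Finset.univ : Finset (Fin k → Fin q)) ⊆ Finset.univ.biUnion E := by
    intro w _
    obtain ⟨i, hi⟩ := hcon w
    exact Finset.mem_biUnion.2 ⟨i, Finset.mem_univ _, by simpa [E] using hi⟩
  have := Finset.card_le_card hcov
  rw [Finset.card_univ, Fintype.card_fun, Fintype.card_fin, Fintype.card_fin] at this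
  have h8 := this.trans (Finset.card_biUnion_le.trans (Finset.sum_le_sum fun i _ => hE i))
  rw [Finset.sum_const, Finset.card_univ, Fintype.card_fin, smul_eq_mul] at h8
  omega

lemma lower_bound_sparse {α p : ℝ} (hα : 0 < α) (hp : 0 < p) (hp2 : p ≤ 2) :
    ∃ c : ℝ, 0 < c ∧ ∀ d n k q : ℕ, 0 < k → 0 < q → k * q ≤ d →
      n * (2 ^ k * q ^ (k / 2)) < q ^ k →
      ENNReal.ofReal (c * (k : ℝ) ^ (-(α * (1 / p - 1 / 2)))) ≤
        adaSamplingNumber n (ridgeClass d α p) := by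
  obtain ⟨c, hc, H⟩ := exists_mul_rpow_le_adaSamplingNumber hα p
  refine ⟨c * (1 / 10) ^ α, by positivity, fun d n k q hk hq hkq hn => ?_⟩
  have hk' : (1 : ℝ) ≤ k := by exact_mod_cast hk
  have hk0 : (0 : ℝ) < k := by linarith
  set t : ℝ := (k : ℝ) ^ (-(1 / p)) with ht
  have ht0 : 0 < t := by positivity
  have hr : √k * t = (k : ℝ) ^ (1 / 2 - 1 / p : ℝ) := by
    rw [Real.sqrt_eq_rpow, ht, ← Real.rpow_add hk0]; rfl
  have hr0 : 0 < √k * t := by positivity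
  have hr1 : √k * t ≤ 1 := by
    rw [hr]
    apply Real.rpow_le_one_of_one_le_of_nonpos hk'
    rw [sub_nonpos]
    exact one_div_le_one_div_of_le hp hp2
  have e : c * (1 / 10) ^ α * (k : ℝ) ^ (-(α * (1 / p - 1 / 2))) =
      c * (1 / 10 * (√k * t)) ^ α := by
    rw [Real.mul_rpow (by norm_num) hr0.le, hr, ← Real.rpow_mul hk0.le, mul_assoc]
    congr 3
    ring
  rw [e]
  refine H d n (9 / 10 * (√k * t)) (1 / 10 * (√k * t)) (by positivity) (by linarith) fun x => ?_
  obtain ⟨w, hw⟩ := exists_word_forall_inner_le hk hq hkq hn ht0 x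
  have hnorm : ‖flatVector t (wordSupport hkq w)‖ = √k * t := by
    rw [← sq_eq_sq₀ (norm_nonneg _) hr0.le, ← real_inner_self_eq_norm_sq, inner_flatVector,
      Finset.inter_self, card_wordSupport, mul_pow, Real.sq_sqrt hk0.le]
  refine ⟨flatVector t (wordSupport hkq w), lpQuasiNorm_le_one_of_sum_le hp ?_, ?_, ?_, hw⟩
  · rw [sum_abs_rpow_flatVector hp ht0.le, card_wordSupport, ht, ← Real.rpow_mul hk0.le,
      neg_mul, one_div_mul_cancel hp.ne', Real.rpow_neg_one, mul_inv_cancel₀ hk0.ne']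
  · rw [hnorm]; exact hr0
  · rw [hnorm]; ring

/-! ### Lower bounds for the adaptive sampling numbers -/

lemma logb_two_le_two_mul {x : ℝ} (hx : 0 ≤ x) : Real.logb 2 (1 + x) ≤ 2 * x := by
  have h1 : Real.log (1 + x) ≤ x := by
    have := Real.log_le_sub_one_of_pos (by linarith : 0 < 1 + x); linarith
  have h2 : (1 / 2 : ℝ) ≤ Real.log 2 := by have := Real.log_two_gt_d9; linarith
  rw [Real.logb, div_le_iff₀ (by linarith)]
  nlinarith

/-- The choice of the word length `k` and the alphabet size `q` for moderate budgets. -/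
lemma exists_word_parameters {d n : ℕ} (hd : 1 ≤ d) (hdn : d ≤ n)
    (hL : 4096 * (2 + Real.logb 2 n) ≤ d) :
    ∃ k q : ℕ, 0 < k ∧ 0 < q ∧ k * q ≤ d ∧ n * (2 ^ k * q ^ (k / 2)) < q ^ k ∧
      (k : ℝ) ≤ 9 * ((2 + Real.logb 2 n) / Real.logb 2 (1 + d / (2 + Real.logb 2 n))) := by
  have hd' : (1 : ℝ) ≤ d := by exact_mod_cast hd
  have hn' : (d : ℝ) ≤ n := by exact_mod_cast hdn
  have hn0 : (0 : ℝ) < n := by linarith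
  have hlogn : 0 ≤ Real.logb 2 n := Real.logb_nonneg (by norm_num) (by linarith)
  set L := 2 + Real.logb 2 n with hLdef
  have hL0 : 0 < L := by linarith
  set y := (d : ℝ) / L with hy
  have hy1 : 4096 ≤ y := by rw [hy, le_div_iff₀ hL0]; exact hL
  set D := Real.logb 2 (1 + y) with hD
  have hD12 : 12 ≤ D := by
    rw [hD, Real.le_logb_iff_rpow_le (by norm_num) (by linarith)]
    have : (2 : ℝ) ^ (12 : ℝ) = 4096 := by
      rw [show (12 : ℝ) = ((12 : ℕ) : ℝ) by norm_num, Real.rpow_natCast]; norm_num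
    linarith
  have hyd : 1 + y ≤ d := by
    have : y * L = d := by rw [hy]; field_simp
    nlinarith
  have hDL : D ≤ L := by
    have h1 : D ≤ Real.logb 2 n :=
      Real.logb_le_logb_of_le (by norm_num) (by linarith) (by linarith)
    linarith
  have hLD : 1 ≤ L / D := by rw [le_div_iff₀ (by linarith)]; linarith
  -- The factor `8` ensures `2 log n + 2 k < k (D - 1) ≤ k log q` in the comparison of squares below.
  set k := ⌈8 * (L / D)⌉₊ with hk
  have hk1 : 8 * (L / D) ≤ k := Nat.le_ceil _
  have hk2 : (k : ℝ) ≤ 9 * (L / D) := by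
    have := Nat.ceil_lt_add_one (by positivity : 0 ≤ 8 * (L / D))
    linarith
  have hk0 : (0 : ℝ) < k := by linarith
  have hkpos : 0 < k := by exact_mod_cast hk0
  set q := d / k with hq
  have hqy : y ≤ q := by
    have h1 : (d : ℝ) / k < q + 1 := by
      rw [div_lt_iff₀ hk0]
      have : d < (q + 1) * k := by
        rw [hq, mul_comm]; exact Nat.lt_mul_div_succ d hkpos
      exact_mod_cast this
    have h2 : y * D / 9 ≤ d / k := by
      rw [le_div_iff₀ hk0]
      calc y * D / 9 * k ≤ y * D / 9 * (9 * (L / D)) := by gcongr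
        _ = y * L := by field_simp
        _ = d := by rw [hy]; field_simp
    nlinarith
  have hq0 : (0 : ℝ) < q := by linarith
  have hqpos : 0 < q := by exact_mod_cast hq0
  refine ⟨k, q, hkpos, hqpos, Nat.mul_div_le d k, ?_, hk2⟩
  have hlogq : D - 1 ≤ Real.logb 2 q := by
    have h1 : D ≤ Real.logb 2 (2 * q) :=
      Real.logb_le_logb_of_le (by norm_num) (by linarith) (by linarith)
    rw [Real.logb_mul (by norm_num) hq0.ne', Real.logb_self_eq_one (by norm_num)] at h1
    linarith
  -- It suffices to compare squares, which removes the rounding in `k / 2`.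
  have hsq : n ^ 2 * 4 ^ k < q ^ k := by
    have hreal : ((n : ℝ) ^ 2 * 4 ^ k) < (q : ℝ) ^ k := by
      rw [← Real.logb_lt_logb_iff (b := 2) (by norm_num) (by positivity) (by positivity),
        Real.logb_mul (by positivity) (by positivity), Real.logb_pow, Real.logb_pow,
        Real.logb_pow]
      have h4 : Real.logb 2 4 = 2 := by
        rw [show (4 : ℝ) = 2 ^ (2 : ℝ) by norm_num, Real.logb_rpow (by norm_num) (by norm_num)]
      rw [h4]
      have h5 : L ≤ k * D / 8 := by
        have : 8 * (L / D) * D = 8 * L := by field_simp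
        nlinarith
      have h6 : (k : ℝ) * (D - 1) ≤ k * Real.logb 2 q := by gcongr
      push_cast
      nlinarith
    exact_mod_cast hreal
  by_contra! hcon
  have h7 : q ^ k * q ^ k ≤ n ^ 2 * 4 ^ k * q ^ k := by
    calc q ^ k * q ^ k ≤ (n * (2 ^ k * q ^ (k / 2))) * (n * (2 ^ k * q ^ (k / 2))) := by gcongr
      _ = n ^ 2 * (2 * 2) ^ k * q ^ (k / 2 + k / 2) := by rw [mul_pow 2 2 k]; ring
      _ ≤ n ^ 2 * 4 ^ k * q ^ k := by
          exact Nat.mul_le_mul_left _ (Nat.pow_le_pow_right hqpos (by omega))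
  exact absurd (Nat.le_of_mul_le_mul_right h7 (by positivity)) (not_le.2 hsq)

lemma lower_bound_moderate_samples {α p : ℝ} (hα : 0 < α) (hp : 0 < p) (hp2 : p ≤ 2) :
    ∃ c : ℝ, 0 < c ∧ ∀ d n : ℕ, 2 ≤ d → d ≤ n → n < 2 ^ (d - 1) →
      ENNReal.ofReal (c *
        (Real.logb 2 (1 + d / (2 + Real.logb 2 n)) / (2 + Real.logb 2 n)) ^
          (α * (1 / p - 1 / 2))) ≤ adaSamplingNumber n (ridgeClass d α p) := by
  obtain ⟨c₁, hc₁, H₁⟩ := lower_bound_sparse hα hp hp2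
  obtain ⟨c₂, hc₂, H₂⟩ := lower_bound_sphere hα hp hp2
  set γ := α * (1 / p - 1 / 2) with hγ
  have hγ0 : 0 ≤ γ := by
    have := one_div_le_one_div_of_le hp hp2
    apply mul_nonneg hα.le; linarith
  set B : ℝ := 2 * 4096 ^ 2 with hB
  refine ⟨min (c₁ * 9 ^ (-γ)) (c₂ * 2 ^ (-2 * α) * B ^ (-γ)), by positivity,
    fun d n hd hdn hn => ?_⟩
  have hd' : (2 : ℝ) ≤ d := by exact_mod_cast hd
  have hn' : (d : ℝ) ≤ n := by exact_mod_cast hdn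
  have hn0 : (0 : ℝ) < n := by linarith
  have hlogn : 0 ≤ Real.logb 2 n := Real.logb_nonneg (by norm_num) (by linarith)
  have hL0 : 0 < 2 + Real.logb 2 n := by linarith
  have hD0 : 0 < Real.logb 2 (1 + d / (2 + Real.logb 2 n)) := by
    apply Real.logb_pos (by norm_num)
    have : 0 < (d : ℝ) / (2 + Real.logb 2 n) := by positivity
    linarith
  by_cases hL : 4096 * (2 + Real.logb 2 n) ≤ d
  · obtain ⟨k, q, hk, hq, hkq, hnkq, hkL⟩ := exists_word_parameters (by omega) hdn hL
    refine le_trans (ENNReal.ofReal_le_ofReal ?_) (H₁ d n k q hk hq hkq hnkq)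
    set L := 2 + Real.logb 2 n
    set D := Real.logb 2 (1 + d / L)
    have hk0 : (0 : ℝ) < k := by exact_mod_cast hk
    have h1 : (9 * (L / D)) ^ (-γ) ≤ (k : ℝ) ^ (-γ) :=
      Real.rpow_le_rpow_of_nonpos hk0 hkL (by linarith)
    have h2 : (9 * (L / D)) ^ (-γ) = 9 ^ (-γ) * (D / L) ^ γ := by
      rw [Real.mul_rpow (by norm_num) (by positivity), Real.rpow_neg (by positivity : 0 ≤ L / D),
        ← Real.inv_rpow (by positivity), inv_div]
    calc min (c₁ * 9 ^ (-γ)) (c₂ * 2 ^ (-2 * α) * B ^ (-γ)) * (D / L) ^ γ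
        ≤ c₁ * 9 ^ (-γ) * (D / L) ^ γ := by gcongr; exact min_le_left _ _
      _ = c₁ * (9 ^ (-γ) * (D / L) ^ γ) := by ring
      _ ≤ c₁ * (k : ℝ) ^ (-γ) := by rw [← h2]; gcongr
  -- Here `2 + log n` is comparable to `d`, so the claimed bound is of the order `d ^ (-γ)` of
  -- the bound on the sphere, in which `n ^ (-2 α / (d - 1))` is bounded below.
  · refine le_trans (ENNReal.ofReal_le_ofReal ?_) (H₂ d n hd (by omega))
    push Not at hL
    set L := 2 + Real.logb 2 n
    set D := Real.logb 2 (1 + d / L)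
    have h1 : D / L ≤ B * (1 / d) := by
      have h2 : D ≤ 2 * (d / L) := logb_two_le_two_mul (by positivity)
      rw [div_le_iff₀ hL0]
      refine h2.trans ?_
      have h3 : (d : ℝ) * d ≤ 4096 * L * (4096 * L) := by gcongr
      rw [mul_div_assoc', div_le_iff₀ hL0, mul_one_div, div_mul_eq_mul_div, div_mul_eq_mul_div,
        le_div_iff₀ (by linarith)]
      rw [hB]
      nlinarith
    have h4 : (2 : ℝ) ^ (-2 * α) ≤ (n : ℝ) ^ (-2 * α / ((d : ℝ) - 1)) := by
      have h5 : (n : ℝ) ≤ 2 ^ ((d : ℝ) - 1) := by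
        have : (n : ℝ) ≤ 2 ^ (d - 1) := by exact_mod_cast hn.le
        rw [← Real.rpow_natCast, Nat.cast_sub (by omega)] at this
        simpa using this
      have h6 : (0 : ℝ) < (d : ℝ) - 1 := by linarith
      calc (2 : ℝ) ^ (-2 * α) = (2 ^ ((d : ℝ) - 1)) ^ (-2 * α / ((d : ℝ) - 1)) := by
            rw [← Real.rpow_mul (by norm_num)]; congr 1; field_simp
        _ ≤ _ := by
            apply Real.rpow_le_rpow_of_nonpos hn0 h5
            apply div_nonpos_of_nonpos_of_nonneg _ h6.le
            linarith
    have h7 : (D / L) ^ γ ≤ B ^ γ * (d : ℝ) ^ (-γ) := by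
      have : (B * (1 / d)) ^ γ = B ^ γ * (d : ℝ) ^ (-γ) := by
        rw [Real.mul_rpow (by positivity) (by positivity), one_div, Real.inv_rpow (by positivity),
          Real.rpow_neg (by positivity)]
      rw [← this]
      gcongr
    have h8 : -α * (1 / p - 1 / 2) = -γ := by rw [hγ]; ring
    rw [h8]
    calc min (c₁ * 9 ^ (-γ)) (c₂ * 2 ^ (-2 * α) * B ^ (-γ)) * (D / L) ^ γ
        ≤ c₂ * 2 ^ (-2 * α) * B ^ (-γ) * (B ^ γ * (d : ℝ) ^ (-γ)) := by
          gcongr; exact min_le_right _ _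
      _ = c₂ * (2 ^ (-2 * α) * (d : ℝ) ^ (-γ)) * (B ^ (-γ) * B ^ γ) := by ring
      _ = c₂ * (2 ^ (-2 * α) * (d : ℝ) ^ (-γ)) := by
          rw [← Real.rpow_add (by positivity), neg_add_cancel, Real.rpow_zero, mul_one]
      _ ≤ _ := by gcongr

/-- The three lower bounds with a common constant. -/
lemma adaptive_lower_bound {α p : ℝ} (hα : 0 < α) (hp : 0 < p) (hp2 : p ≤ 2) :
    ∃ c : ℝ, 0 < c ∧ ∀ d n : ℕ, 2 ≤ d →
      (n < d → ENNReal.ofReal c ≤ adaSamplingNumber n (ridgeClass d α p)) ∧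
      (d ≤ n → n < 2 ^ (d - 1) →
        ENNReal.ofReal (c *
            (Real.logb 2 (1 + d / (2 + Real.logb 2 n)) / (2 + Real.logb 2 n)) ^
              (α * (1 / p - 1 / 2))) ≤
          adaSamplingNumber n (ridgeClass d α p)) ∧
      (2 ^ (d - 1) ≤ n →
        ENNReal.ofReal (c * ((n : ℝ) ^ (-2 * α / ((d : ℝ) - 1)) *
            (d : ℝ) ^ (-α * (1 / p - 1 / 2)))) ≤
          adaSamplingNumber n (ridgeClass d α p)) := by
  obtain ⟨c₁, hc₁, H₁⟩ := lower_bound_few_samples hα hp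
  obtain ⟨c₂, hc₂, H₂⟩ := lower_bound_moderate_samples hα hp hp2
  obtain ⟨c₃, hc₃, H₃⟩ := lower_bound_sphere hα hp hp2
  refine ⟨min c₁ (min c₂ c₃), by positivity, fun d n hd => ⟨fun h => ?_, fun h h' => ?_,
    fun h => ?_⟩⟩
  · exact (ENNReal.ofReal_le_ofReal (min_le_left _ _)).trans (H₁ d n h)
  · refine (ENNReal.ofReal_le_ofReal ?_).trans (H₂ d n hd h h')
    have hlog : 0 ≤ Real.logb 2 n :=
      Real.logb_nonneg (by norm_num) (by exact_mod_cast (by omega : 1 ≤ n))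
    have hD : 0 ≤ Real.logb 2 (1 + d / (2 + Real.logb 2 n)) := by
      apply Real.logb_nonneg (by norm_num)
      have : 0 ≤ (d : ℝ) / (2 + Real.logb 2 n) := by positivity
      linarith
    gcongr
    exact (min_le_right _ _).trans (min_le_left _ _)
  · refine (ENNReal.ofReal_le_ofReal ?_).trans (H₃ d n hd (Nat.one_le_two_pow.trans h))
    gcongr
    exact (min_le_right _ _).trans (min_le_right _ _)

/-! ### Taylor expansion of profiles -/

/-- The Taylor polynomial of degree `s` on `[-1,1]` with base point `t₀`. -/
noncomputable def profileTaylor (s : ℕ) (g : ℝ → ℝ) (t₀ t : ℝ) : ℝ :=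
  ∑ k ∈ Finset.range (s + 1), profileDeriv k g t₀ / (k.factorial : ℝ) * (t - t₀) ^ k

lemma hasDerivAt_sum_div_factorial (c : ℕ → ℝ) (s : ℕ) (t₀ t : ℝ) :
    HasDerivAt (fun t => ∑ k ∈ Finset.range (s + 2), c k / (k.factorial : ℝ) * (t - t₀) ^ k)
      (∑ k ∈ Finset.range (s + 1), c (k + 1) / (k.factorial : ℝ) * (t - t₀) ^ k) t := by
  have h : ∀ k ∈ Finset.range (s + 2),
      HasDerivAt (fun t => c k / (k.factorial : ℝ) * (t - t₀) ^ k)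
        (c k / (k.factorial : ℝ) * (k * (t - t₀) ^ (k - 1))) t := by
    intro k _
    have := (((hasDerivAt_id t).sub_const t₀).pow k).const_mul (c k / (k.factorial : ℝ))
    simpa using this
  refine (HasDerivAt.fun_sum h).congr_deriv ?_
  rw [Finset.sum_range_succ']
  simp only [Nat.cast_zero, zero_mul, mul_zero, add_zero, Nat.add_sub_cancel]
  refine Finset.sum_congr rfl fun k _ => ?_
  rw [Nat.factorial_succ]
  push_cast
  field_simp

/-- The remainder is integrated up from the top derivative by the mean value inequality. -/
lemma abs_sub_profileTaylor_le {β : ℝ} (hβ : 0 ≤ β) (s : ℕ) :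
    ∀ g : ℝ → ℝ, ContDiffOn ℝ s g (Icc (-1) 1) →
      (∀ t ∈ Icc (-1 : ℝ) 1, ∀ u ∈ Icc (-1 : ℝ) 1,
        |profileDeriv s g t - profileDeriv s g u| ≤ 2 * |t - u| ^ β) →
      ∀ t₀ ∈ Icc (-1 : ℝ) 1, ∀ t ∈ Icc (-1 : ℝ) 1,
        |g t - profileTaylor s g t₀ t| ≤ 2 * |t - t₀| ^ (s + β) := by
  have huniq : UniqueDiffOn ℝ (Icc (-1 : ℝ) 1) := uniqueDiffOn_Icc (by norm_num)
  induction s with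
  | zero =>
    intro g _ hH t₀ ht₀ t ht
    simpa [profileTaylor, profileDeriv] using hH t ht t₀ ht₀
  | succ s ih =>
    intro g hg hH t₀ ht₀ t ht
    have hsucc : ∀ k x, profileDeriv (k + 1) g x =
        profileDeriv k (derivWithin g (Icc (-1) 1)) x := fun k x =>
      congrFun iteratedDerivWithin_succ' x
    have hg' : ContDiffOn ℝ s (derivWithin g (Icc (-1) 1)) (Icc (-1) 1) :=
      hg.derivWithin huniq (by exact_mod_cast le_rfl)
    have ih' := ih _ hg' (fun t ht u hu => by rw [← hsucc, ← hsucc]; exact hH t ht u hu) t₀ ht₀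
    have hsub : uIcc t₀ t ⊆ Icc (-1) 1 := by
      rw [uIcc]
      exact Icc_subset_Icc (le_inf ht₀.1 ht.1) (sup_le ht₀.2 ht.2)
    have hder : ∀ x ∈ uIcc t₀ t, HasDerivWithinAt (fun x => g x - profileTaylor (s + 1) g t₀ x)
        (derivWithin g (Icc (-1) 1) x - profileTaylor s (derivWithin g (Icc (-1) 1)) t₀ x)
        (uIcc t₀ t) x := by
      intro x hx
      have h1 : HasDerivWithinAt g (derivWithin g (Icc (-1) 1) x) (Icc (-1) 1) x :=
        (hg.differentiableOn (by simp) x (hsub hx)).hasDerivWithinAt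
      have h2 := hasDerivAt_sum_div_factorial (fun k => profileDeriv k g t₀) s t₀ x
      simp only [hsucc] at h2
      exact (h1.mono hsub).sub h2.hasDerivWithinAt
    have hbound : ∀ x ∈ uIcc t₀ t,
        ‖derivWithin g (Icc (-1) 1) x - profileTaylor s (derivWithin g (Icc (-1) 1)) t₀ x‖ ≤
          2 * |t - t₀| ^ (s + β) := by
      intro x hx
      refine (ih' x (hsub hx)).trans ?_
      have : |x - t₀| ≤ |t - t₀| := abs_sub_left_of_mem_uIcc hx
      gcongr
    have hmv := (convex_uIcc t₀ t).norm_image_sub_le_of_norm_hasDerivWithin_le hder hbound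
      left_mem_uIcc right_mem_uIcc
    have h0 : g t₀ - profileTaylor (s + 1) g t₀ t₀ = 0 := by
      rw [profileTaylor, Finset.sum_range_succ']
      simp [profileDeriv]
    rw [h0, sub_zero, Real.norm_eq_abs, Real.norm_eq_abs] at hmv
    refine hmv.trans (le_of_eq ?_)
    rcases (abs_nonneg (t - t₀)).eq_or_lt with h | h
    · have hne : ((s + 1 : ℕ) : ℝ) + β ≠ 0 := by push_cast; positivity
      rw [← h, Real.zero_rpow hne, mul_zero, mul_zero]
    · have : ((s + 1 : ℕ) : ℝ) + β = (s + β) + 1 := by push_cast; ring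
      rw [this, Real.rpow_add_one h.ne']
      ring

lemma abs_sub_profileTaylor_le_of_mem {α : ℝ} (hα : 0 < α) {g : ℝ → ℝ} (hg : g ∈ lipUnitBall α)
    {t₀ t : ℝ} (ht₀ : t₀ ∈ Icc (-1 : ℝ) 1) (ht : t ∈ Icc (-1 : ℝ) 1) :
    |g t - profileTaylor (strictFloor α) g t₀ t| ≤ 2 * |t - t₀| ^ α := by
  obtain ⟨h1, _, h3⟩ := mem_lipUnitBall_iff.1 hg
  have hβ : 0 ≤ α - strictFloor α := by linarith [strictFloor_lt hα]
  have := abs_sub_profileTaylor_le hβ _ g h1 (fun t ht u hu => (h3 t ht u hu).trans (by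
    gcongr; exact min_le_right _ _)) t₀ ht₀ t ht
  rwa [add_sub_cancel] at this

/-! ### Interpolation of ridge polynomials -/

/-- The homogeneous coordinates `(1, x₁, …, x_d)` of a point. -/
def homCoord {d : ℕ} (i : Fin (d + 1)) (x : EuclideanSpace ℝ (Fin d)) : ℝ :=
  (Fin.cons 1 x : Fin (d + 1) → ℝ) i

/-- Products of `s` homogeneous coordinates: the monomials of degree at most `s`. -/
def homMonomial {d s : ℕ} (f : Fin s → Fin (d + 1)) (x : EuclideanSpace ℝ (Fin d)) : ℝ :=
  ∏ j, homCoord (f j) x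

/-- The polynomial functions of degree at most `s` on `ℝ^d`. -/
def polySpace (d s : ℕ) : Submodule ℝ (EuclideanSpace ℝ (Fin d) → ℝ) :=
  Submodule.span ℝ (range (homMonomial (d := d) (s := s)))

instance polySpace_finiteDimensional (d s : ℕ) : FiniteDimensional ℝ (polySpace d s) :=
  FiniteDimensional.span_of_finite ℝ (finite_range _)

/-- Monomials are indexed by multisets of homogeneous coordinates. -/
lemma finrank_polySpace_le (d s : ℕ) :
    Module.finrank ℝ (polySpace d s) ≤ (d + s).choose s := by
  let b : Sym (Fin (d + 1)) s → EuclideanSpace ℝ (Fin d) → ℝ := fun τ x =>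
    (τ.1.map fun i => homCoord i x).prod
  have hsub : range (homMonomial (d := d) (s := s)) ⊆ range b := by
    rintro _ ⟨f, rfl⟩
    refine ⟨⟨Finset.univ.val.map f, by simp⟩, ?_⟩
    ext x
    simp only [b, Multiset.map_map]
    rfl
  have h1 : Module.finrank ℝ (Submodule.span ℝ (range b)) ≤ (d + s).choose s := by
    have h2 := finrank_range_le_card (R := ℝ) b
    rw [Sym.card_sym_eq_choose, Fintype.card_fin] at h2
    rwa [show d + 1 + s - 1 = d + s by omega] at h2
  have : FiniteDimensional ℝ (Submodule.span ℝ (range b)) :=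
    FiniteDimensional.span_of_finite ℝ (finite_range _)
  exact (Submodule.finrank_mono (Submodule.span_mono hsub)).trans h1

lemma prod_sum_mem_polySpace {d s : ℕ} (L : Fin s → Fin (d + 1) → ℝ) :
    (fun x => ∏ j, ∑ i, L j i * homCoord i x) ∈ polySpace d s := by
  have : (fun x => ∏ j, ∑ i, L j i * homCoord i x) =
      ∑ f : Fin s → Fin (d + 1), (∏ j, L j (f j)) • homMonomial f := by
    ext x
    rw [Finset.prod_univ_sum, Fintype.piFinset_univ, Finset.sum_apply]
    refine Finset.sum_congr rfl fun f _ => ?_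
    rw [Pi.smul_apply, smul_eq_mul, homMonomial, Finset.prod_mul_distrib]
  rw [this]
  exact Submodule.sum_mem _ fun f _ => Submodule.smul_mem _ _ (Submodule.subset_span ⟨f, rfl⟩)

lemma inner_add_const_pow_mem_polySpace {d s k : ℕ} (hk : k ≤ s) (a : EuclideanSpace ℝ (Fin d))
    (c : ℝ) : (fun x => (inner ℝ a x + c) ^ k) ∈ polySpace d s := by
  convert prod_sum_mem_polySpace (d := d) (s := s)
    (fun j => if (j : ℕ) < k then Fin.cons c a else Fin.cons 1 0) using 2 with x
  have h1 : ∀ j : Fin s, ∑ i, (if (j : ℕ) < k then Fin.cons c a else Fin.cons 1 0 :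
      Fin (d + 1) → ℝ) i * homCoord i x = if (j : ℕ) < k then inner ℝ a x + c else 1 := by
    intro j
    split_ifs
    · rw [Fin.sum_univ_succ, ← sum_mul_eq_inner]
      simp [homCoord, add_comm]
    · rw [Fin.sum_univ_succ]
      simp [homCoord]
  simp_rw [h1]
  rw [Fin.prod_univ_eq_prod_range (fun j => if j < k then inner ℝ a x + c else 1),
    Finset.prod_ite, Finset.prod_const_one, mul_one, Finset.prod_const]
  congr 1
  have : (Finset.range s).filter (fun j => j < k) = Finset.range k := by
    ext j; simp; omega
  rw [this, Finset.card_range]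

lemma continuous_of_mem_polySpace {d s : ℕ} {v : EuclideanSpace ℝ (Fin d) → ℝ}
    (hv : v ∈ polySpace d s) : Continuous v := by
  induction hv using Submodule.span_induction with
  | mem v hv =>
    obtain ⟨f, rfl⟩ := hv
    refine continuous_finsetProd _ fun j _ => ?_
    refine Fin.cases ?_ (fun i => ?_) (f j)
    · exact continuous_const
    · change Continuous fun x : EuclideanSpace ℝ (Fin d) => x i
      fun_prop
  | zero => exact continuous_const
  | add v w _ _ hv hw => exact hv.add hw
  | smul c v _ hv => exact hv.const_smul c

lemma abs_le_of_mem_polySpace {d s : ℕ} {v : EuclideanSpace ℝ (Fin d) → ℝ}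
    (hv : v ∈ polySpace d s) :
    ∃ C : ℝ, 0 ≤ C ∧ ∀ z, ‖z‖ ≤ 2 → ∀ h : ℝ, 0 < h → h ≤ 1 → |v (h⁻¹ • z)| ≤ C * h⁻¹ ^ s := by
  induction hv using Submodule.span_induction with
  | mem v hv =>
    obtain ⟨f, rfl⟩ := hv
    refine ⟨2 ^ s, by positivity, fun z hz h h0 h1 => ?_⟩
    rw [homMonomial, Finset.abs_prod, ← mul_pow]
    have hinv : 1 ≤ h⁻¹ := (one_le_inv₀ h0).2 h1
    have hle : ∀ j, |homCoord (f j) (h⁻¹ • z)| ≤ 2 * h⁻¹ := by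
      intro j
      refine Fin.cases ?_ (fun i => ?_) (f j)
      · simp only [homCoord, Fin.cons_zero, abs_one]; linarith
      · simp only [homCoord, Fin.cons_succ, PiLp.smul_apply, smul_eq_mul]
        rw [abs_mul, abs_of_pos (by positivity), mul_comm]
        gcongr
        exact (PiLp.norm_apply_le z i).trans hz
    calc ∏ j, |homCoord (f j) (h⁻¹ • z)| ≤ ∏ _j : Fin s, (2 * h⁻¹) :=
          Finset.prod_le_prod (fun _ _ => abs_nonneg _) fun j _ => hle j
      _ = _ := by simp
  | zero => exact ⟨0, le_rfl, by simp⟩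
  | add v w _ _ hv hw =>
    obtain ⟨C, hC, hv⟩ := hv
    obtain ⟨C', hC', hw⟩ := hw
    refine ⟨C + C', by positivity, fun z hz h h0 h1 => ?_⟩
    have := abs_add_le (v (h⁻¹ • z)) (w (h⁻¹ • z))
    have e1 := hv z hz h h0 h1
    have e2 := hw z hz h h0 h1
    rw [Pi.add_apply, add_mul]
    linarith
  | smul c v _ hv =>
    obtain ⟨C, hC, hv⟩ := hv
    refine ⟨|c| * C, by positivity, fun z hz h h0 h1 => ?_⟩
    rw [Pi.smul_apply, smul_eq_mul, abs_mul, mul_assoc]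
    gcongr
    exact hv z hz h h0 h1

/-- Every finite-dimensional space of functions has a unisolvent set of nodes with a Lagrange
basis. The nodes are chosen so that their evaluation functionals form a basis of the dual. -/
lemma exists_lagrange_basis {X : Type*} (V : Submodule ℝ (X → ℝ)) [FiniteDimensional ℝ V] :
    ∃ (ξ : Fin (Module.finrank ℝ V) → X) (l : Fin (Module.finrank ℝ V) → V),
      ∀ v ∈ V, ∀ x, v x = ∑ j, v (ξ j) * (l j : X → ℝ) x := by
  let e : X → Module.Dual ℝ V := fun x => (LinearMap.proj x).comp V.subtype
  obtain ⟨κ, a, -, hspan, hli⟩ := exists_linearIndependent' ℝ e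
  have : Finite κ := hli.finite
  let _ : Fintype κ := Fintype.ofFinite κ
  let ev : V →ₗ[ℝ] (κ → ℝ) := LinearMap.pi fun j => e (a j)
  have hinj : Function.Injective ev := by
    rw [← LinearMap.ker_eq_bot, LinearMap.ker_eq_bot']
    intro v hv
    have hz : ∀ φ ∈ Submodule.span ℝ (range (e ∘ a)), φ v = 0 := by
      intro φ hφ
      induction hφ using Submodule.span_induction with
      | mem φ hφ => obtain ⟨j, rfl⟩ := hφ; exact congrFun hv j
      | zero => rfl
      | add φ χ _ _ h1 h2 => rw [LinearMap.add_apply, h1, h2, add_zero]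
      | smul c φ _ h1 => rw [LinearMap.smul_apply, h1, smul_zero]
    ext x
    exact hz (e x) (hspan ▸ Submodule.subset_span ⟨x, rfl⟩)
  have h1 : Fintype.card κ ≤ Module.finrank ℝ V := by
    have := hli.fintype_card_le_finrank
    rwa [Subspace.dual_finrank_eq] at this
  have h2 : Module.finrank ℝ V ≤ Fintype.card κ := by
    have := LinearMap.finrank_le_finrank_of_injective hinj
    rwa [Module.finrank_fintype_fun_eq_card] at this
  have hcard : Fintype.card (Fin (Module.finrank ℝ V)) = Fintype.card κ := by
    rw [Fintype.card_fin]; omega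
  have hsurj : Function.Surjective ev :=
    (LinearMap.injective_iff_surjective_of_finrank_eq_finrank (by
      rw [Module.finrank_fintype_fun_eq_card]; omega)).1 hinj
  classical
  let E := LinearEquiv.ofBijective ev ⟨hinj, hsurj⟩
  let σ := Fintype.equivOfCardEq hcard
  refine ⟨a ∘ σ, fun j => E.symm (Pi.single (σ j) 1), fun v hv x => ?_⟩
  have key : (⟨v, hv⟩ : V) = ∑ j, v (a j) • E.symm (Pi.single j 1) := by
    apply E.injective
    rw [map_sum]
    simp_rw [map_smul, LinearEquiv.apply_symm_apply]
    ext j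
    simp only [Finset.sum_apply, Pi.smul_apply, smul_eq_mul]
    rw [Finset.sum_eq_single j]
    · simp only [Pi.single_eq_same, mul_one]; rfl
    · intro i _ hi; simp [hi.symm]
    · simp
  have h3 := congrArg (fun w : V => (w : X → ℝ) x) key
  simp only [Submodule.coe_sum, Submodule.coe_smul, Finset.sum_apply, Pi.smul_apply,
    smul_eq_mul] at h3
  rw [h3]
  exact (Equiv.sum_comp σ fun j => v (a j) * (E.symm (Pi.single j 1) : X → ℝ) x).symm

/-! ### Linear algorithms from nets -/

lemma norm_le_one_of_lpQuasiNorm_le_one {d : ℕ} {p : ℝ} (hp : 0 < p) (hp2 : p ≤ 2)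
    {a : EuclideanSpace ℝ (Fin d)} (h : lpQuasiNorm p a ≤ 1) : ‖a‖ ≤ 1 := by
  have h1 := sum_le_one_of_lpQuasiNorm_le_one hp h
  have hle : ∀ i, |a i| ≤ 1 := by
    intro i
    by_contra! hlt
    have h2 := Finset.single_le_sum (f := fun i => |a i| ^ p) (fun _ _ => by positivity)
      (Finset.mem_univ i)
    exact absurd (h2.trans h1) (not_le.2 (Real.one_lt_rpow hlt hp))
  have h3 : ‖a‖ ^ 2 ≤ 1 := by
    rw [EuclideanSpace.real_norm_sq_eq]
    refine (Finset.sum_le_sum fun i _ => ?_).trans h1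
    rw [← sq_abs, ← Real.rpow_two]
    rcases (abs_nonneg (a i)).eq_or_lt with h0 | h0
    · rw [← h0, Real.zero_rpow (by norm_num), Real.zero_rpow hp.ne']
    · exact Real.rpow_le_rpow_of_exponent_ge h0 (hle i) hp2
  nlinarith [norm_nonneg a]

lemma inner_mem_Icc {d : ℕ} {a x : EuclideanSpace ℝ (Fin d)} (ha : ‖a‖ ≤ 1) (hx : ‖x‖ ≤ 1) :
    inner ℝ a x ∈ Icc (-1 : ℝ) 1 := by
  rw [mem_Icc, ← abs_le]
  exact (abs_real_inner_le_norm a x).trans (mul_le_one₀ ha (norm_nonneg _) hx)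

/-- Function values at `binom (d+s) s` nodes close to `y` reproduce, by a linear formula, every
ridge function up to the error of its Taylor polynomial. The nodes lie on a scale `h` so small that
the growth `h ^ (-s)` of the Lagrange functions is beaten by the Taylor error `h ^ α` at the
nodes. -/
lemma exists_local_reconstruction {α : ℝ} (hα : 0 < α) (d : ℕ) {r : ℝ} (hr : 0 < r) :
    ∃ m ≤ (d + strictFloor α).choose (strictFloor α), ∀ y : UnitBall d,
      ∃ (z : Fin m → UnitBall d) (l : Fin m → UnitBall d → ℝ), (∀ j, Continuous (l j)) ∧
        ∀ g ∈ lipUnitBall α, ∀ a : EuclideanSpace ℝ (Fin d), ‖a‖ ≤ 1 → ∀ x : UnitBall d,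
          |inner ℝ a (x.1 - y.1)| ≤ r →
          |g (inner ℝ a x.1) - ∑ j, g (inner ℝ a (z j).1) * l j x| ≤ 3 * r ^ α := by
  set s := strictFloor α with hs
  have hsα : (s : ℝ) < α := strictFloor_lt hα
  obtain ⟨m, hm, ξ, L, hL⟩ : ∃ m ≤ (d + s).choose s, ∃ (ξ : Fin m → EuclideanSpace ℝ (Fin d))
      (L : Fin m → polySpace d s), ∀ v ∈ polySpace d s, ∀ x,
        v x = ∑ j, v (ξ j) * (L j : EuclideanSpace ℝ (Fin d) → ℝ) x :=
    ⟨_, finrank_polySpace_le d s, exists_lagrange_basis (polySpace d s)⟩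
  obtain ⟨R, hR1, hR⟩ : ∃ R : ℝ, 1 ≤ R ∧ ∀ j, ‖ξ j‖ ≤ R := by
    have h0 : 0 ≤ ∑ j, ‖ξ j‖ := by positivity
    refine ⟨1 + ∑ j, ‖ξ j‖, by linarith, fun j => ?_⟩
    have := Finset.single_le_sum (f := fun j => ‖ξ j‖) (fun _ _ => norm_nonneg _)
      (Finset.mem_univ j)
    linarith
  obtain ⟨C, hC0, hC⟩ : ∃ C : ℝ, 0 ≤ C ∧ ∀ j z, ‖z‖ ≤ 2 → ∀ h : ℝ, 0 < h → h ≤ 1 →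
      |(L j : EuclideanSpace ℝ (Fin d) → ℝ) (h⁻¹ • z)| ≤ C * h⁻¹ ^ s := by
    choose c hc0 hc using fun j => abs_le_of_mem_polySpace (L j).2
    refine ⟨∑ j, c j, Finset.sum_nonneg fun j _ => hc0 j, fun j z hz h h0 h1 => ?_⟩
    refine (hc j z hz h h0 h1).trans ?_
    gcongr
    exact Finset.single_le_sum (f := c) (fun j _ => hc0 j) (Finset.mem_univ j)
  set K : ℝ := m * (2 * R ^ α * C) with hK
  obtain ⟨h, hh0, hhR, hh⟩ : ∃ h : ℝ, 0 < h ∧ h * R ≤ 1 ∧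
      2 * (r + h * R) ^ α + K * h ^ (α - s) ≤ 3 * r ^ α := by
    have hlim : Filter.Tendsto (fun h : ℝ => 2 * (r + h * R) ^ α + K * h ^ (α - s))
        (nhdsWithin 0 (Ioi 0)) (nhds (2 * (r + 0 * R) ^ α + K * 0 ^ (α - s))) := by
      apply Filter.Tendsto.mono_left _ nhdsWithin_le_nhds
      apply ContinuousAt.tendsto
      apply ContinuousAt.add
      · apply continuousAt_const.mul
        apply ContinuousAt.rpow_const (by fun_prop)
        right; exact hα.le
      · apply continuousAt_const.mul
        exact Real.continuousAt_rpow_const _ _ (Or.inr (by linarith))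
    rw [zero_mul, add_zero, Real.zero_rpow (by linarith), mul_zero, add_zero] at hlim
    have hrα : 0 < r ^ α := by positivity
    have e1 := hlim.eventually (ge_mem_nhds (show 2 * r ^ α < 3 * r ^ α by linarith))
    have e2 : ∀ᶠ h : ℝ in nhdsWithin 0 (Ioi 0), h * R ≤ 1 := by
      have : Filter.Tendsto (fun h : ℝ => h * R) (nhdsWithin 0 (Ioi 0)) (nhds (0 * R)) :=
        ((continuous_id.mul continuous_const).tendsto 0).mono_left nhdsWithin_le_nhds
      rw [zero_mul] at this
      exact this.eventually (ge_mem_nhds one_pos)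
    obtain ⟨h, h1, h2, h3⟩ := (e1.and (e2.and self_mem_nhdsWithin)).exists
    exact ⟨h, h3, h2, h1⟩
  have hh1 : h ≤ 1 := by nlinarith
  have hhR0 : 0 < h * R := by positivity
  refine ⟨m, hm, fun y => ?_⟩
  have hy : ‖y.1‖ ≤ 1 := mem_closedBall_zero_iff.1 y.2
  set c : EuclideanSpace ℝ (Fin d) := (1 - h * R) • y.1 with hc
  have hcn : ‖c‖ ≤ 1 - h * R := by
    rw [hc, norm_smul, Real.norm_of_nonneg (by linarith)]
    exact mul_le_of_le_one_right (by linarith) hy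
  have hz : ∀ j, ‖c + h • ξ j‖ ≤ 1 := by
    intro j
    have h1 : ‖h • ξ j‖ ≤ h * R := by
      rw [norm_smul, Real.norm_of_nonneg hh0.le]
      have := hR j
      gcongr
    linarith [norm_add_le c (h • ξ j)]
  refine ⟨fun j => ⟨c + h • ξ j, mem_closedBall_zero_iff.2 (hz j)⟩,
    fun j x => (L j : EuclideanSpace ℝ (Fin d) → ℝ) (h⁻¹ • (x.1 - c)), fun j => ?_,
    fun g hg a ha x hx => ?_⟩
  · have := continuous_of_mem_polySpace (L j).2
    fun_prop
  have hx1 : ‖x.1‖ ≤ 1 := mem_closedBall_zero_iff.1 x.2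
  set t₀ : ℝ := inner ℝ a c with ht₀
  have ht₀I : t₀ ∈ Icc (-1 : ℝ) 1 := inner_mem_Icc ha (by linarith)
  -- The Taylor polynomial composed with `w ↦ a · (c + h w)` is interpolated exactly.
  have hpoly : (fun w => profileTaylor s g t₀ (t₀ + inner ℝ (h • a) w)) ∈ polySpace d s := by
    have : (fun w => profileTaylor s g t₀ (t₀ + inner ℝ (h • a) w)) =
        ∑ k ∈ Finset.range (s + 1), (profileDeriv k g t₀ / (k.factorial : ℝ)) •
          fun w => (inner ℝ (h • a) w + 0) ^ k := by
      ext w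
      simp [profileTaylor, Finset.sum_apply]
    rw [this]
    exact Submodule.sum_mem _ fun k hk => Submodule.smul_mem _ _
      (inner_add_const_pow_mem_polySpace (Nat.lt_succ_iff.1 (Finset.mem_range.1 hk)) _ _)
  have hexact := hL _ hpoly (h⁻¹ • (x.1 - c))
  have e1 : t₀ + inner ℝ (h • a) (h⁻¹ • (x.1 - c)) = inner ℝ a x.1 := by
    rw [real_inner_smul_left, real_inner_smul_right, mul_inv_cancel_left₀ hh0.ne', inner_sub_right,
      ht₀]
    ring
  have e2 : ∀ j, t₀ + inner ℝ (h • a) (ξ j) = inner ℝ a (c + h • ξ j) := by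
    intro j
    rw [real_inner_smul_left, inner_add_right a c, real_inner_smul_right a (ξ j)]
  simp only [e1, e2] at hexact
  have hxt : |inner ℝ a x.1 - t₀| ≤ r + h * R := by
    have : inner ℝ a x.1 - t₀ = inner ℝ a (x.1 - y.1) + h * R * inner ℝ a y.1 := by
      rw [ht₀, hc, real_inner_smul_right, inner_sub_right]; ring
    rw [this]
    have h2 : |inner ℝ a y.1| ≤ 1 := abs_le.2 (inner_mem_Icc ha hy)
    have h3 : |h * R * inner ℝ a y.1| ≤ h * R := by
      rw [abs_mul, abs_of_pos hhR0]
      exact mul_le_of_le_one_right hhR0.le h2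
    linarith [abs_add_le (inner ℝ a (x.1 - y.1)) (h * R * inner ℝ a y.1)]
  have hT : |g (inner ℝ a x.1) - profileTaylor s g t₀ (inner ℝ a x.1)| ≤ 2 * (r + h * R) ^ α :=
    (abs_sub_profileTaylor_le_of_mem hα hg ht₀I (inner_mem_Icc ha hx1)).trans (by gcongr)
  have hnode : ∀ j, |g (inner ℝ a (c + h • ξ j)) -
      profileTaylor s g t₀ (inner ℝ a (c + h • ξ j))| ≤ 2 * (h * R) ^ α := by
    intro j
    refine (abs_sub_profileTaylor_le_of_mem hα hg ht₀I (inner_mem_Icc ha (hz j))).trans ?_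
    have : |inner ℝ a (c + h • ξ j) - t₀| ≤ h * R := by
      rw [ht₀, ← inner_sub_right, add_sub_cancel_left, real_inner_smul_right, abs_mul,
        abs_of_pos hh0]
      have h4 := (abs_real_inner_le_norm a (ξ j)).trans
        (mul_le_mul ha (hR j) (norm_nonneg _) zero_le_one)
      rw [one_mul] at h4
      gcongr
    gcongr
  have hnorm2 : ‖x.1 - c‖ ≤ 2 := by linarith [norm_sub_le x.1 c]
  have hsum : |∑ j, (g (inner ℝ a (c + h • ξ j)) -
      profileTaylor s g t₀ (inner ℝ a (c + h • ξ j))) *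
        (L j : EuclideanSpace ℝ (Fin d) → ℝ) (h⁻¹ • (x.1 - c))| ≤ K * h ^ (α - s) := by
    calc _ ≤ ∑ j, |(g (inner ℝ a (c + h • ξ j)) -
          profileTaylor s g t₀ (inner ℝ a (c + h • ξ j))) *
            (L j : EuclideanSpace ℝ (Fin d) → ℝ) (h⁻¹ • (x.1 - c))| :=
          Finset.abs_sum_le_sum_abs _ _
      _ ≤ ∑ _j : Fin m, 2 * (h * R) ^ α * (C * h⁻¹ ^ s) := by
          refine Finset.sum_le_sum fun j _ => ?_
          rw [abs_mul]
          exact mul_le_mul (hnode j) (hC j _ hnorm2 h hh0 hh1) (abs_nonneg _) (by positivity)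
      _ = K * h ^ (α - s) := by
          rw [Finset.sum_const, Finset.card_univ, Fintype.card_fin, nsmul_eq_mul,
            Real.mul_rpow hh0.le (by linarith), Real.rpow_sub hh0, Real.rpow_natCast, inv_pow, hK]
          field_simp
  have hsplit : g (inner ℝ a x.1) - ∑ j, g (inner ℝ a (c + h • ξ j)) *
      (L j : EuclideanSpace ℝ (Fin d) → ℝ) (h⁻¹ • (x.1 - c)) =
      (g (inner ℝ a x.1) - profileTaylor s g t₀ (inner ℝ a x.1)) -
      ∑ j, (g (inner ℝ a (c + h • ξ j)) -
        profileTaylor s g t₀ (inner ℝ a (c + h • ξ j))) *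
          (L j : EuclideanSpace ℝ (Fin d) → ℝ) (h⁻¹ • (x.1 - c)) := by
    simp_rw [sub_mul]
    rw [Finset.sum_sub_distrib, ← hexact]
    ring
  rw [hsplit]
  refine (abs_sub _ _).trans (le_trans (add_le_add hT hsum) hh)

/-- A net of the unit ball with respect to the metric which is dual to the unit ball of `ℓ_p^d`. -/
def IsDualNet {d M : ℕ} (p r : ℝ) (y : Fin M → UnitBall d) : Prop :=
  ∀ x : UnitBall d, ∃ i, ∀ a : EuclideanSpace ℝ (Fin d), lpQuasiNorm p a ≤ 1 →
    |inner ℝ a (x.1 - (y i).1)| ≤ r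

lemma linSamplingNumber_le_one {α p : ℝ} (hp : 0 < p) (hp2 : p ≤ 2) (d n : ℕ) :
    linSamplingNumber n (ridgeClass d α p) ≤ 1 := by
  refine iInf₂_le_of_le (fun _ => 0) ⟨0, Nat.zero_le _, Fin.elim0, 0, fun f => rfl⟩ ?_
  refine iSup₂_le fun f hf => ?_
  obtain ⟨g, hg, a, ha, hfa⟩ := hf
  have hb : ∀ x, ‖f x‖ ≤ 1 := by
    intro x
    rw [hfa x]
    have ha1 := norm_le_one_of_lpQuasiNorm_le_one hp hp2 (a := WithLp.toLp 2 a) ha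
    have h1 : ∑ i, a i * x.1 i = inner ℝ (WithLp.toLp 2 a) x.1 := by rw [← sum_mul_eq_inner]
    rw [h1]
    exact (mem_lipUnitBall_iff.1 hg).2.1 0 (Nat.zero_le _) _
      (inner_mem_Icc ha1 (mem_closedBall_zero_iff.1 x.2))
  have h0 : eLpNorm (fun x => f x - (0 : LInfty d) x) ∞ (ballMeasure d) =
      eLpNorm f ∞ (ballMeasure d) := by simp
  rw [h0, eLpNorm_exponent_top, ← ENNReal.ofReal_one]
  exact eLpNormEssSup_le_of_ae_bound (Filter.Eventually.of_forall hb)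

/-- A dual net of radius `r` with `M` points, refined by the local nodes, gives a linear algorithm
with error of order `r ^ α`. On each cell of the partition generated by the net, the local
reconstruction belonging to the cell is used. -/
lemma linSamplingNumber_le_of_isDualNet {α p : ℝ} (hα : 0 < α) (hp : 0 < p) (hp2 : p ≤ 2)
    {d M n : ℕ} {r : ℝ} (hr : 0 < r) {y : Fin M → UnitBall d} (hy : IsDualNet p r y)
    (hn : M * (d + strictFloor α).choose (strictFloor α) ≤ n) :
    linSamplingNumber n (ridgeClass d α p) ≤ ENNReal.ofReal (3 * r ^ α) := by
  classical
  obtain ⟨m, hm, hloc⟩ := exists_local_reconstruction hα d hr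
  choose z l hlc hl using fun i => hloc (y i)
  let U : Fin M → Set (UnitBall d) := fun i =>
    {x | ∀ a : EuclideanSpace ℝ (Fin d), lpQuasiNorm p a ≤ 1 → |inner ℝ a (x.1 - (y i).1)| ≤ r}
  have hU : ∀ i, MeasurableSet (U i) := by
    intro i
    apply IsClosed.measurableSet
    have : U i = ⋂ a : EuclideanSpace ℝ (Fin d), ⋂ _ : lpQuasiNorm p a ≤ 1,
        {x : UnitBall d | |inner ℝ a (x.1 - (y i).1)| ≤ r} := by
      ext x; simp [U]
    rw [this]
    refine isClosed_iInter fun a => isClosed_iInter fun _ => isClosed_le ?_ continuous_const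
    fun_prop
  -- The cell of `i` consists of the points for which `i` is the first admissible index.
  let P : Fin M → Set (UnitBall d) := fun i => U i ∩ ⋂ j : Fin M, ⋂ _ : j < i, (U j)ᶜ
  have hP : ∀ i, MeasurableSet (P i) := fun i =>
    (hU i).inter (MeasurableSet.iInter fun j => MeasurableSet.iInter fun _ => (hU j).compl)
  have hPex : ∀ x, ∃ i, x ∈ P i ∧ ∀ j ≠ i, x ∉ P j := by
    intro x
    obtain ⟨i, hi, hmin⟩ := WellFounded.has_min (wellFounded_lt (α := Fin M)) {i | x ∈ U i} (hy x)
    have hiP : x ∈ P i := ⟨hi, by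
      simp only [mem_iInter]
      exact fun j hj hxj => hmin j hxj hj⟩
    refine ⟨i, hiP, fun j hj hxj => ?_⟩
    rcases lt_or_gt_of_ne hj with h | h
    · exact hmin j hxj.1 h
    · have := hxj.2
      simp only [mem_iInter] at this
      exact this i h hi
  let b : Fin M × Fin m → UnitBall d → ℝ := fun q => (P q.1).indicator (l q.1 q.2)
  have hb : ∀ q, MemLp (b q) ∞ (ballMeasure d) := by
    intro q
    obtain ⟨C, hC⟩ := isCompact_univ.exists_bound_of_continuousOn (hlc q.1 q.2).continuousOn
    refine memLp_top_of_bound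
      ((hlc q.1 q.2).measurable.indicator (hP q.1)).aestronglyMeasurable C
      (Filter.Eventually.of_forall fun x => ?_)
    exact (norm_indicator_le_norm_self _ _).trans (hC x (mem_univ x))
  let e := finProdFinEquiv (m := M) (n := m)
  let φ : (Fin (M * m) → ℝ) →ₗ[ℝ] LInfty d :=
    ∑ t, (LinearMap.proj t : (Fin (M * m) → ℝ) →ₗ[ℝ] ℝ).smulRight ((hb (e.symm t)).toLp)
  refine iInf₂_le_of_le (fun f => φ fun t => f (z (e.symm t).1 (e.symm t).2))
    ⟨M * m, (Nat.mul_le_mul_left _ hm).trans hn, fun t => z (e.symm t).1 (e.symm t).2, φ,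
      fun f => rfl⟩ ?_
  refine iSup₂_le fun f hf => ?_
  obtain ⟨g, hg, a, ha, hfa⟩ := hf
  set a' : EuclideanSpace ℝ (Fin d) := WithLp.toLp 2 a with ha'
  have hfa' : ∀ x, f x = g (inner ℝ a' x.1) := fun x => by
    rw [hfa x, ← sum_mul_eq_inner]
  have ha1 : ‖a'‖ ≤ 1 := norm_le_one_of_lpQuasiNorm_le_one hp hp2 ha
  rw [eLpNorm_exponent_top]
  apply eLpNormEssSup_le_of_ae_bound
  have hφ : ∀ v : Fin (M * m) → ℝ, φ v = ∑ t, v t • (hb (e.symm t)).toLp := by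
    intro v; simp [φ]
  have hae1 := Lp.coeFn_fun_finsetSum Finset.univ (fun t : Fin (M * m) =>
    f (z (e.symm t).1 (e.symm t).2) • (hb (e.symm t)).toLp)
  have hae2 : ∀ᵐ x ∂(ballMeasure d), ∀ t : Fin (M * m),
      (f (z (e.symm t).1 (e.symm t).2) • (hb (e.symm t)).toLp : LInfty d) x =
        f (z (e.symm t).1 (e.symm t).2) * b (e.symm t) x := by
    rw [ae_all_iff]
    intro t
    filter_upwards [Lp.coeFn_smul (f (z (e.symm t).1 (e.symm t).2)) (hb (e.symm t)).toLp,
      (hb (e.symm t)).coeFn_toLp] with x h1 h2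
    rw [h1, Pi.smul_apply, h2, smul_eq_mul]
  filter_upwards [hae1, hae2] with x h1 h2
  obtain ⟨i, hi, hne⟩ := hPex x
  have hval : (φ fun t => f (z (e.symm t).1 (e.symm t).2)) x =
      ∑ j, g (inner ℝ a' (z i j).1) * l i j x := by
    rw [hφ, h1]
    simp_rw [h2]
    rw [Equiv.sum_comp e.symm fun q => f (z q.1 q.2) * b q x, Fintype.sum_prod_type,
      Finset.sum_eq_single i]
    · refine Finset.sum_congr rfl fun j _ => ?_
      simp only [b, indicator_of_mem hi, hfa']
    · intro k _ hk
      refine Finset.sum_eq_zero fun j _ => ?_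
      simp only [b, indicator_of_notMem (hne k hk), mul_zero]
    · simp
  rw [hval, hfa', Real.norm_eq_abs]
  exact hl i g hg a' ha1 x (hi.1 a' ha)

/-! ### Nets of the Euclidean ball -/

/-- Stars and bars, as an enumeration. -/
lemma exists_enum_sum_le (T : Type*) [Fintype T] (K : ℕ) :
    ∃ c : Fin ((Fintype.card T + K).choose K) → T → ℕ,
      ∀ w : T → ℕ, ∑ t, w t ≤ K → ∃ i, c i = w := by
  classical
  let E := Sym.equivNatSumOfFintype (Option T) K
  have hcard : Fintype.card (Sym (Option T) K) = (Fintype.card T + K).choose K := by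
    rw [Sym.card_sym_eq_choose, Fintype.card_option]
    congr 1; omega
  let e := Fintype.equivFinOfCardEq hcard
  refine ⟨fun i t => (E (e.symm i)).1 (some t), fun w hw => ?_⟩
  let P : {P : Option T → ℕ // ∑ i, P i = K} :=
    ⟨fun o => o.elim (K - ∑ t, w t) w, by
      rw [Fintype.sum_option]; simp only [Option.elim_none, Option.elim_some]; omega⟩
  refine ⟨e (E.symm P), ?_⟩
  ext t
  simp only [Equiv.symm_apply_apply, Equiv.apply_symm_apply]
  rfl

/-- A covering of the ball by sup-norm balls whose centres are indexed by a small type can be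
listed with centres in the ball. -/
lemma exists_supNet_of_card_le {ι : Type*} [Fintype ι] {d M : ℕ} {η : ℝ}
    (Y : ι → EuclideanSpace ℝ (Fin d)) (hM : Fintype.card ι ≤ M)
    (hY : ∀ x : UnitBall d, ∃ i, ‖Y i‖ ≤ 1 ∧ ∀ c, |x.1 c - Y i c| ≤ η) :
    ∃ y : Fin M → UnitBall d, ∀ x : UnitBall d, ∃ i, ∀ c, |x.1 c - (y i).1 c| ≤ η := by
  classical
  obtain ⟨i₀, -⟩ := hY ⟨0, Metric.mem_closedBall_self zero_le_one⟩
  have : Nonempty ι := ⟨i₀⟩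
  obtain ⟨f⟩ := Function.Embedding.nonempty_of_card_le (α := ι) (β := Fin M) (by simpa using hM)
  refine ⟨fun t => if h : ‖Y (Function.invFun f t)‖ ≤ 1 then
    ⟨Y (Function.invFun f t), mem_closedBall_zero_iff.2 h⟩ else
    ⟨0, Metric.mem_closedBall_self zero_le_one⟩, fun x => ?_⟩
  obtain ⟨i, hi1, hi2⟩ := hY x
  refine ⟨f i, ?_⟩
  have hinv : Function.invFun f (f i) = i := Function.leftInverse_invFun f.injective i
  simp only [hinv, hi1, dif_pos]
  exact hi2

/-- Rounding a real number towards zero to a multiple of `η`. -/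
lemma abs_sub_sign_mul_floor_le {η t : ℝ} (hη : 0 < η) :
    |t - (if t < 0 then -1 else 1) * (η * ⌊|t| / η⌋₊)| ≤ η := by
  have h1 : (⌊|t| / η⌋₊ : ℝ) ≤ |t| / η := Nat.floor_le (by positivity)
  have h2 : |t| / η < ⌊|t| / η⌋₊ + 1 := Nat.lt_floor_add_one _
  rw [le_div_iff₀ hη] at h1
  rw [div_lt_iff₀ hη] at h2
  split_ifs with h
  · rw [abs_of_neg h] at *
    rw [abs_le]; constructor <;> linarith
  · rw [abs_of_nonneg (not_lt.1 h)] at *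
    rw [abs_le]; constructor <;> linarith

lemma sum_sq_mul_floor_le {d : ℕ} (x : UnitBall d) {η : ℝ} (hη : 0 < η) :
    ∑ c, (η * (⌊|x.1 c| / η⌋₊ : ℝ)) ^ 2 ≤ 1 := by
  have hx : ‖x.1‖ ^ 2 ≤ 1 := pow_le_one₀ (norm_nonneg _) (mem_closedBall_zero_iff.1 x.2)
  rw [EuclideanSpace.real_norm_sq_eq] at hx
  refine (Finset.sum_le_sum fun c _ => ?_).trans hx
  rw [← sq_abs (x.1 c)]
  have h1 : (⌊|x.1 c| / η⌋₊ : ℝ) ≤ |x.1 c| / η := Nat.floor_le (by positivity)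
  rw [le_div_iff₀ hη] at h1
  gcongr
  linarith

lemma norm_toLp_sign_mul_le_one {d : ℕ} (x : UnitBall d) {η : ℝ} (hη : 0 < η) :
    ‖(WithLp.toLp 2 fun c => (if x.1 c < 0 then -1 else 1) * (η * (⌊|x.1 c| / η⌋₊ : ℝ)) :
      EuclideanSpace ℝ (Fin d))‖ ≤ 1 := by
  have h1 := sum_sq_mul_floor_le x hη
  have h2 : ‖(WithLp.toLp 2 fun c => (if x.1 c < 0 then -1 else 1) * (η * (⌊|x.1 c| / η⌋₊ : ℝ)) :
      EuclideanSpace ℝ (Fin d))‖ ^ 2 ≤ 1 := by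
    rw [EuclideanSpace.real_norm_sq_eq]
    refine (Finset.sum_le_sum fun c _ => ?_).trans h1
    dsimp only
    split_ifs <;> simp
  nlinarith [norm_nonneg (WithLp.toLp 2 fun c => (if x.1 c < 0 then -1 else 1) *
    (η * (⌊|x.1 c| / η⌋₊ : ℝ)) : EuclideanSpace ℝ (Fin d))]

/-- The sparse regime: a lattice point of mesh `η` in the unit ball has `ℓ_1`-norm at most
`η ^ (-2)` in lattice units, since its entries are integers there. -/
lemma exists_supNet_sparse {d M K : ℕ} {η : ℝ} (hη : 0 < η) (hK : 1 ≤ η ^ 2 * K)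
    (hM : (2 * d + K).choose K ≤ M) :
    ∃ y : Fin M → UnitBall d, ∀ x : UnitBall d, ∃ i, ∀ c, |x.1 c - (y i).1 c| ≤ η := by
  obtain ⟨w, hw⟩ := exists_enum_sum_le (Fin d × Bool) K
  have hcard : Fintype.card (Fin d × Bool) = 2 * d := by simp [mul_comm]
  rw [← hcard] at hM
  refine exists_supNet_of_card_le (fun i => WithLp.toLp 2 fun c =>
    η * ((w i (c, false) : ℝ) - w i (c, true))) (by simpa using hM) fun x => ?_
  let k : Fin d → ℕ := fun c => ⌊|x.1 c| / η⌋₊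
  have hsum : ∑ c, k c ≤ K := by
    have h1 := sum_sq_mul_floor_le x hη
    have h2 : η ^ 2 * ∑ c, (k c : ℝ) ≤ η ^ 2 * K := by
      refine le_trans ?_ (h1.trans hK)
      rw [Finset.mul_sum]
      refine Finset.sum_le_sum fun c _ => ?_
      rw [mul_pow]
      gcongr
      exact_mod_cast Nat.le_self_pow (by norm_num) (k c)
    have h3 := le_of_mul_le_mul_left h2 (by positivity)
    exact_mod_cast h3
  obtain ⟨i, hi⟩ := hw (fun q => if q.2 = decide (x.1 q.1 < 0) then k q.1 else 0) (by
    rw [Fintype.sum_prod_type]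
    refine le_trans (Finset.sum_le_sum fun c _ => ?_) hsum
    by_cases h : x.1 c < 0 <;> simp [h])
  have hval : (WithLp.toLp 2 fun c => η * ((w i (c, false) : ℝ) - w i (c, true)) :
      EuclideanSpace ℝ (Fin d)) =
      WithLp.toLp 2 fun c => (if x.1 c < 0 then -1 else 1) * (η * (⌊|x.1 c| / η⌋₊ : ℝ)) := by
    congr 1
    ext c
    rw [hi]
    by_cases h : x.1 c < 0 <;> simp [h, k]
  refine ⟨i, ?_⟩
  rw [hval]
  exact ⟨norm_toLp_sign_mul_le_one x hη, fun c => abs_sub_sign_mul_floor_le hη⟩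

/-- The dense regime: signs and absolute values of the lattice points are counted separately, and
the `ℓ_1`-norm of a point of the unit ball is at most `√d`. -/
lemma exists_supNet_dense {d M K : ℕ} {η : ℝ} (hη : 0 < η) (hK : √d ≤ η * K)
    (hM : 2 ^ d * (d + K).choose K ≤ M) :
    ∃ y : Fin M → UnitBall d, ∀ x : UnitBall d, ∃ i, ∀ c, |x.1 c - (y i).1 c| ≤ η := by
  obtain ⟨w, hw⟩ := exists_enum_sum_le (Fin d) K
  refine exists_supNet_of_card_le (ι := (Fin d → Bool) × Fin ((Fintype.card (Fin d) + K).choose K))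
    (fun q => WithLp.toLp 2 fun c =>
      (if q.1 c then -1 else 1) * (η * (w q.2 c : ℝ))) (by simpa using hM) fun x => ?_
  let k : Fin d → ℕ := fun c => ⌊|x.1 c| / η⌋₊
  have hsum : ∑ c, k c ≤ K := by
    have h1 := sum_sq_mul_floor_le x hη
    have h2 : (∑ c, η * (k c : ℝ)) ^ 2 ≤ d := by
      have h3 := sq_sum_le_card_mul_sum_sq (s := (Finset.univ : Finset (Fin d)))
        (f := fun c => η * (k c : ℝ))
      rw [Finset.card_univ, Fintype.card_fin] at h3
      refine h3.trans ?_
      exact mul_le_of_le_one_right (by positivity) h1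
    have h4 : η * ∑ c, (k c : ℝ) ≤ η * K := by
      refine le_trans ?_ hK
      rw [Finset.mul_sum]
      exact Real.le_sqrt_of_sq_le h2
    have h3 := le_of_mul_le_mul_left h4 hη
    exact_mod_cast h3
  obtain ⟨i, hi⟩ := hw k hsum
  refine ⟨(fun c => decide (x.1 c < 0), i), ?_⟩
  simp only [hi, decide_eq_true_eq]
  exact ⟨norm_toLp_sign_mul_le_one x hη, fun c => abs_sub_sign_mul_floor_le hη⟩

/-- Interpolation between `ℓ_2` and `ℓ_∞` on the dual side. -/
lemma abs_inner_le_of_abs_le {d : ℕ} {p : ℝ} (hp : 0 < p) (hp2 : p ≤ 2)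
    {a z : EuclideanSpace ℝ (Fin d)} (ha : lpQuasiNorm p a ≤ 1) {Z B : ℝ} (hZ : 0 ≤ Z)
    (hz : ∀ i, |z i| ≤ Z) (hzB : ‖z‖ ≤ B) :
    |inner ℝ a z| ≤ Z ^ (2 / max 1 p - 1) * B ^ (2 - 2 / max 1 p) := by
  have hsum := sum_le_one_of_lpQuasiNorm_le_one hp ha
  set P := max 1 p with hP
  have hP1 : 1 ≤ P := le_max_left _ _
  have hP2 : P ≤ 2 := max_le (by norm_num) hp2
  have hP0 : 0 < P := by linarith
  have hle : ∀ i, |a i| ≤ 1 := by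
    intro i
    by_contra! hlt
    have h2 := Finset.single_le_sum (f := fun i => |a i| ^ p) (fun _ _ => by positivity)
      (Finset.mem_univ i)
    exact absurd (h2.trans hsum) (not_le.2 (Real.one_lt_rpow hlt hp))
  have hsumP : ∑ i, |a i| ^ P ≤ 1 := by
    refine (Finset.sum_le_sum fun i _ => ?_).trans hsum
    rcases (abs_nonneg (a i)).eq_or_lt with h0 | h0
    · rw [← h0, Real.zero_rpow hp.ne', Real.zero_rpow hP0.ne']
    · exact Real.rpow_le_rpow_of_exponent_ge h0 (hle i) (le_max_right _ _)
  have hin : |inner ℝ a z| ≤ ∑ i, |a i| * |z i| := by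
    rw [← sum_mul_eq_inner]
    refine (Finset.abs_sum_le_sum_abs _ _).trans (le_of_eq ?_)
    simp_rw [abs_mul]
  have hθ1 : 0 ≤ 2 / P - 1 := by rw [sub_nonneg, le_div_iff₀ hP0]; linarith
  rcases hP1.eq_or_lt with h1 | h1
  · have e1 : Z ^ (2 / P - 1) * B ^ (2 - 2 / P) = Z := by
      rw [← h1]; norm_num
    rw [e1]
    calc |inner ℝ a z| ≤ ∑ i, |a i| * |z i| := hin
      _ ≤ ∑ i, |a i| * Z := by gcongr with i; exact hz i
      _ = (∑ i, |a i| ^ P) * Z := by rw [← Finset.sum_mul, ← h1]; simp_rw [Real.rpow_one]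
      _ ≤ 1 * Z := by gcongr
      _ = Z := one_mul Z
  · have hconj := Real.HolderConjugate.conjExponent h1
    set q := P.conjExponent with hq
    have hq0 : 0 < q := hconj.symm.pos
    have hqθ : 2 - 2 / P = 2 / q := by
      have h3 := hconj.inv_add_inv_eq_one
      rw [div_eq_mul_inv, div_eq_mul_inv]
      linarith
    have hθ0 : 0 ≤ 2 - 2 / P := by rw [hqθ]; positivity
    have hterm : ∀ i, |z i| ≤ Z ^ (2 / P - 1) * |z i| ^ (2 - 2 / P) := by
      intro i
      have e : |z i| = |z i| ^ (2 / P - 1) * |z i| ^ (2 - 2 / P) := by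
        rw [← Real.rpow_add_of_nonneg (abs_nonneg _) hθ1 hθ0]
        have : 2 / P - 1 + (2 - 2 / P) = 1 := by ring
        rw [this, Real.rpow_one]
      calc |z i| = |z i| ^ (2 / P - 1) * |z i| ^ (2 - 2 / P) := e
        _ ≤ _ := by
          gcongr
          exact hz i
    have hholder := Real.inner_le_Lp_mul_Lq_of_nonneg Finset.univ hconj
      (f := fun i => |a i|) (g := fun i => |z i| ^ (2 - 2 / P)) (fun i _ => abs_nonneg _)
      (fun i _ => by positivity)
    have e2 : ∑ i, (|z i| ^ (2 - 2 / P)) ^ q = ‖z‖ ^ 2 := by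
      rw [EuclideanSpace.real_norm_sq_eq]
      refine Finset.sum_congr rfl fun i _ => ?_
      rw [← Real.rpow_mul (abs_nonneg _), hqθ, div_mul_cancel₀ _ hq0.ne', Real.rpow_two, sq_abs]
    have e3 : (∑ i, |a i| ^ P) ^ (1 / P) ≤ 1 :=
      Real.rpow_le_one (by positivity) hsumP (by positivity)
    have e4 : (∑ i, (|z i| ^ (2 - 2 / P)) ^ q) ^ (1 / q) ≤ B ^ (2 - 2 / P) := by
      rw [e2, ← Real.rpow_two, ← Real.rpow_mul (norm_nonneg _), mul_one_div, ← hqθ]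
      gcongr
    calc |inner ℝ a z| ≤ ∑ i, |a i| * |z i| := hin
      _ ≤ ∑ i, |a i| * (Z ^ (2 / P - 1) * |z i| ^ (2 - 2 / P)) := by
          gcongr with i; exact hterm i
      _ = Z ^ (2 / P - 1) * ∑ i, |a i| * |z i| ^ (2 - 2 / P) := by
          rw [Finset.mul_sum]; refine Finset.sum_congr rfl fun i _ => by ring
      _ ≤ Z ^ (2 / P - 1) * (1 * B ^ (2 - 2 / P)) := by
          gcongr
          refine hholder.trans ?_
          exact mul_le_mul e3 e4 (by positivity) zero_le_one
      _ = _ := by rw [one_mul]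

lemma isDualNet_sparse {d M K : ℕ} {p : ℝ} (hp : 0 < p) (hp2 : p ≤ 2) (hK : 1 ≤ K)
    (hM : (2 * d + K).choose K ≤ M) :
    ∃ y : Fin M → UnitBall d, IsDualNet p (2 * (K : ℝ) ^ (-(1 / max 1 p - 1 / 2))) y := by
  have hK0 : (0 : ℝ) < K := by exact_mod_cast hK
  set η : ℝ := (K : ℝ) ^ (-(1 / 2 : ℝ)) with hη
  have hη0 : 0 < η := by positivity
  have hηK : 1 ≤ η ^ 2 * K := by
    rw [hη, ← Real.rpow_natCast, ← Real.rpow_mul hK0.le]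
    have : -(1 / 2 : ℝ) * (2 : ℕ) = -1 := by norm_num
    rw [this, Real.rpow_neg_one, inv_mul_cancel₀ hK0.ne']
  obtain ⟨y, hy⟩ := exists_supNet_sparse hη0 hηK hM
  refine ⟨y, fun x => ?_⟩
  obtain ⟨i, hi⟩ := hy x
  refine ⟨i, fun a ha => ?_⟩
  have hnorm : ‖x.1 - (y i).1‖ ≤ 2 := by
    have h1 : ‖x.1‖ ≤ 1 := mem_closedBall_zero_iff.1 x.2
    have h2 : ‖(y i).1‖ ≤ 1 := mem_closedBall_zero_iff.1 (y i).2
    linarith [norm_sub_le x.1 (y i).1]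
  have hP1 : 1 ≤ max 1 p := le_max_left _ _
  have hP2 : max 1 p ≤ 2 := max_le (by norm_num) hp2
  set P := max 1 p
  refine (abs_inner_le_of_abs_le hp hp2 ha hη0.le hi hnorm).trans ?_
  have e1 : η ^ (2 / P - 1) = (K : ℝ) ^ (-(1 / P - 1 / 2)) := by
    rw [hη, ← Real.rpow_mul hK0.le]
    congr 1; ring
  have e2 : (2 : ℝ) ^ (2 - 2 / P) ≤ 2 := by
    calc (2 : ℝ) ^ (2 - 2 / P) ≤ 2 ^ (1 : ℝ) := by
          apply Real.rpow_le_rpow_of_exponent_le (by norm_num)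
          have : 1 ≤ 2 / P := by rw [le_div_iff₀ (by linarith)]; linarith
          linarith
      _ = 2 := Real.rpow_one 2
  rw [e1, mul_comm]
  gcongr

lemma isDualNet_dense {d M K : ℕ} {p η : ℝ} (hp : 0 < p) (hp2 : p ≤ 2) (hd : 1 ≤ d)
    (hη : 0 < η) (hK : √d ≤ η * K) (hM : 2 ^ d * (d + K).choose K ≤ M) :
    ∃ y : Fin M → UnitBall d, IsDualNet p (η * (d : ℝ) ^ (1 - 1 / max 1 p)) y := by
  have hd0 : (0 : ℝ) < d := by exact_mod_cast hd
  obtain ⟨y, hy⟩ := exists_supNet_dense hη hK hM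
  refine ⟨y, fun x => ?_⟩
  obtain ⟨i, hi⟩ := hy x
  refine ⟨i, fun a ha => ?_⟩
  have hnorm : ‖x.1 - (y i).1‖ ≤ √d * η := by
    have h1 : ‖x.1 - (y i).1‖ ^ 2 ≤ (√d * η) ^ 2 := by
      rw [EuclideanSpace.real_norm_sq_eq, mul_pow, Real.sq_sqrt hd0.le]
      calc ∑ c, (x.1 - (y i).1) c ^ 2 ≤ ∑ _c : Fin d, η ^ 2 := by
            refine Finset.sum_le_sum fun c _ => ?_
            rw [← sq_abs]
            gcongr
            exact hi c
        _ = d * η ^ 2 := by simp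
    exact le_of_sq_le_sq h1 (by positivity)
  have hP1 : 1 ≤ max 1 p := le_max_left _ _
  set P := max 1 p
  refine (abs_inner_le_of_abs_le hp hp2 ha hη.le hi hnorm).trans (le_of_eq ?_)
  rw [Real.mul_rpow (by positivity) hη.le, Real.sqrt_eq_rpow, ← Real.rpow_mul hd0.le]
  have e1 : η ^ (2 / P - 1) * η ^ (2 - 2 / P) = η := by
    rw [← Real.rpow_add hη]
    have : 2 / P - 1 + (2 - 2 / P) = 1 := by ring
    rw [this, Real.rpow_one]
  have e2 : (1 / 2 : ℝ) * (2 - 2 / P) = 1 - 1 / P := by ring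
  rw [e2]
  calc _ = (η ^ (2 / P - 1) * η ^ (2 - 2 / P)) * (d : ℝ) ^ (1 - 1 / P) := by ring
    _ = _ := by rw [e1]

/-! ### Upper bounds for the linear sampling numbers -/

lemma choose_le_three_mul_div_pow {n k : ℕ} (hk : 1 ≤ k) :
    (n.choose k : ℝ) ≤ (3 * n / k) ^ k := by
  have hk0 : (0 : ℝ) < k := by exact_mod_cast hk
  have hf : (0 : ℝ) < k.factorial := by exact_mod_cast k.factorial_pos
  have h1 : (n.choose k : ℝ) ≤ (n : ℝ) ^ k / k.factorial := Nat.choose_le_pow_div k n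
  have h2 := Real.pow_div_factorial_le_exp _ hk0.le k
  have h3 : Real.exp k ≤ 3 ^ k := by
    rw [← Real.exp_one_pow]
    have := Real.exp_one_lt_d9
    gcongr
    linarith
  have h4 : (k : ℝ) ^ k ≤ 3 ^ k * k.factorial := by
    rw [← div_le_iff₀ hf]; exact h2.trans h3
  refine h1.trans ?_
  rw [div_pow, mul_pow, div_le_div_iff₀ hf (by positivity)]
  calc (n : ℝ) ^ k * (k : ℝ) ^ k ≤ (n : ℝ) ^ k * (3 ^ k * k.factorial) := by gcongr
    _ = _ := by ring

lemma linSamplingNumber_antitone {d m n : ℕ} (h : m ≤ n) (F : Set (UnitBall d → ℝ)) :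
    linSamplingNumber n F ≤ linSamplingNumber m F := by
  refine le_iInf₂ fun S hS => iInf₂_le S ?_
  obtain ⟨k, hk, hS⟩ := hS
  exact ⟨k, hk.trans h, hS⟩

lemma reducedBudget_le_div {d s n : ℕ} (h : 1 ≤ reducedBudget d s n) :
    reducedBudget d s n ≤ (n / (d + s).choose s : ℕ) := by
  have hN : 0 < (d + s).choose s := Nat.choose_pos (by omega)
  have hN' : (0 : ℝ) < (d + s).choose s := by exact_mod_cast hN
  have h1 : (n : ℝ) < (n / (d + s).choose s + 1 : ℕ) * (d + s).choose s := by
    have := Nat.lt_mul_div_succ n hN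
    rw [mul_comm]
    exact_mod_cast this
  have h2 : (n : ℝ) = 2 * reducedBudget d s n * (d + s).choose s := by
    rw [reducedBudget]; field_simp
  rw [h2] at h1
  have h3 := lt_of_mul_lt_mul_right h1 hN'.le
  push_cast at h3
  linarith

/-- The number of nodes of the sparse net, for mesh parameter `K` of order `L / D`. -/
lemma choose_le_two_rpow {d K : ℕ} {L : ℝ} (hL0 : 0 < L) (hLd : L ≤ d) (hK : 1 ≤ K)
    (hK1 : (K : ℝ) ≤ L / (32 * Real.logb 2 (1 + d / L)))
    (hK2 : L / (64 * Real.logb 2 (1 + d / L)) ≤ K) :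
    ((2 * d + K).choose K : ℝ) ≤ 2 ^ L := by
  have hK0 : (0 : ℝ) < K := by exact_mod_cast hK
  set y := (d : ℝ) / L with hy
  have hy1 : 1 ≤ y := by rw [hy, le_div_iff₀ hL0]; linarith
  set D := Real.logb 2 (1 + y) with hD
  have hD1 : 1 ≤ D := by
    rw [hD, Real.le_logb_iff_rpow_le (by norm_num) (by linarith), Real.rpow_one]; linarith
  have hD2 : D ≤ 2 * y := logb_two_le_two_mul (by linarith)
  refine (choose_le_three_mul_div_pow hK).trans ?_
  have h1 : 3 * ((2 * d + K : ℕ) : ℝ) / K ≤ 1024 * (1 + y) ^ 2 := by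
    have h2 : (d : ℝ) / K ≤ 64 * (y * D) := by
      rw [div_le_iff₀ hK0]
      calc (d : ℝ) = 64 * (y * D) * (L / (64 * D)) := by rw [hy]; field_simp
        _ ≤ 64 * (y * D) * K := by gcongr
    have h3 : 3 * ((2 * d + K : ℕ) : ℝ) / K = 6 * (d / K) + 3 := by
      push_cast; field_simp; ring
    rw [h3]
    nlinarith
  have h4 : (1024 * (1 + y) ^ 2 : ℝ) = 2 ^ (10 + 2 * D) := by
    rw [Real.rpow_add (by norm_num), mul_comm (2 : ℝ) D, Real.rpow_mul (by norm_num), hD,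
      Real.rpow_logb (by norm_num) (by norm_num) (by linarith), Real.rpow_two]
    norm_num
  calc (3 * ((2 * d + K : ℕ) : ℝ) / K) ^ K ≤ (1024 * (1 + y) ^ 2) ^ K := by gcongr
    _ = 2 ^ ((10 + 2 * D) * K) := by
        rw [h4, ← Real.rpow_natCast, ← Real.rpow_mul (by norm_num)]
    _ ≤ 2 ^ L := by
        apply Real.rpow_le_rpow_of_exponent_le (by norm_num)
        rw [le_div_iff₀ (by positivity)] at hK1
        nlinarith

lemma upper_bound_moderate_samples {α p : ℝ} (hα : 0 < α) (hp : 0 < p) (hp2 : p ≤ 2) :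
    ∃ C : ℝ, 0 < C ∧ ∀ d n : ℕ, 1 ≤ d →
      2 * d * (d + strictFloor α).choose (strictFloor α) < n →
      n ≤ 2 ^ (d + 1) * (d + strictFloor α).choose (strictFloor α) →
      linSamplingNumber n (ridgeClass d α p) ≤ ENNReal.ofReal (C *
        (Real.logb 2 (1 + d / Real.logb 2 (reducedBudget d (strictFloor α) n)) /
          Real.logb 2 (reducedBudget d (strictFloor α) n)) ^ (α * (1 / max 1 p - 1 / 2))) := by
  set s := strictFloor α with hs
  have hP1 : 1 ≤ max 1 p := le_max_left _ _
  have hP2 : max 1 p ≤ 2 := max_le (by norm_num) hp2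
  set P := max 1 p with hP
  have hγ' : 0 ≤ 1 / P - 1 / 2 := by
    have := one_div_le_one_div_of_le (by linarith) hP2
    linarith
  set γ := α * (1 / P - 1 / 2) with hγ
  have hγ0 : 0 ≤ γ := mul_nonneg hα.le hγ'
  refine ⟨3 * 2 ^ α * 64 ^ γ, by positivity, fun d n hd hn1 hn2 => ?_⟩
  have hd' : (1 : ℝ) ≤ d := by exact_mod_cast hd
  have hN : 0 < (d + s).choose s := Nat.choose_pos (by omega)
  have hN' : (0 : ℝ) < (d + s).choose s := by exact_mod_cast hN
  have hb1 : (d : ℝ) < reducedBudget d s n := by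
    rw [reducedBudget, lt_div_iff₀ (by positivity)]
    have : (2 * d * (d + s).choose s : ℝ) < n := by exact_mod_cast hn1
    linarith
  have hb2 : reducedBudget d s n ≤ 2 ^ (d : ℝ) := by
    rw [reducedBudget, div_le_iff₀ (by positivity), Real.rpow_natCast]
    have : (n : ℝ) ≤ 2 ^ (d + 1) * (d + s).choose s := by exact_mod_cast hn2
    rw [pow_succ] at this
    linarith
  set b := reducedBudget d s n with hb
  have hb0 : 0 < b := by linarith
  set L := Real.logb 2 b with hL
  have hL0 : 0 < L := Real.logb_pos (by norm_num) (by linarith)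
  have hLd : L ≤ d := by
    rw [hL, Real.logb_le_iff_le_rpow (by norm_num) hb0]; exact hb2
  have hy1 : 1 ≤ (d : ℝ) / L := by rw [le_div_iff₀ hL0]; linarith
  set D := Real.logb 2 (1 + d / L) with hD
  have hD1 : 1 ≤ D := by
    rw [hD, Real.le_logb_iff_rpow_le (by norm_num) (by linarith), Real.rpow_one]; linarith
  have h2α : (1 : ℝ) ≤ 2 ^ α := Real.one_le_rpow (by norm_num) hα.le
  have hDL : (64 : ℝ) ^ γ * (D / L) ^ γ = (64 * (D / L)) ^ γ := by
    rw [Real.mul_rpow (by norm_num) (by positivity)]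
  set K := ⌊L / (32 * D)⌋₊ with hK
  have hKle : (K : ℝ) ≤ L / (32 * D) := Nat.floor_le (by positivity)
  have hKlt : L / (32 * D) < K + 1 := Nat.lt_floor_add_one _
  -- If `K = 0`, then `D / L` is bounded below and the trivial bound `1` is good enough.
  rcases Nat.eq_zero_or_pos K with h0 | hKpos
  · refine (linSamplingNumber_le_one hp hp2 d n).trans ?_
    rw [ENNReal.one_le_ofReal, mul_assoc, hDL]
    rw [h0] at hKlt
    simp only [Nat.cast_zero, zero_add] at hKlt
    rw [div_lt_one (by positivity)] at hKlt
    have h1 : 1 ≤ 64 * (D / L) := by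
      rw [mul_div_assoc', le_div_iff₀ hL0]; linarith
    have h2 := Real.one_le_rpow h1 hγ0
    nlinarith
  · have hK1 : (1 : ℝ) ≤ K := by exact_mod_cast hKpos
    have hKge : L / (64 * D) ≤ K := by
      have : L / (64 * D) = L / (32 * D) / 2 := by field_simp; norm_num
      linarith
    have hcount : (2 * d + K).choose K ≤ n / (d + s).choose s := by
      have h1 := choose_le_two_rpow hL0 hLd hKpos hKle hKge
      rw [hL, Real.rpow_logb (by norm_num) (by norm_num) hb0] at h1
      have h2 := h1.trans (reducedBudget_le_div (by linarith))
      exact_mod_cast h2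
    obtain ⟨y, hy⟩ := isDualNet_sparse hp hp2 hKpos hcount
    have hr : 0 < 2 * (K : ℝ) ^ (-(1 / max 1 p - 1 / 2)) := by positivity
    refine (linSamplingNumber_le_of_isDualNet hα hp hp2 hr hy (Nat.div_mul_le_self _ _)).trans
      (ENNReal.ofReal_le_ofReal ?_)
    rw [Real.mul_rpow (by norm_num) (by positivity), ← Real.rpow_mul (by positivity)]
    have e1 : (K : ℝ) ^ (-(1 / max 1 p - 1 / 2) * α) ≤ 64 ^ γ * (D / L) ^ γ := by
      have : -(1 / max 1 p - 1 / 2) * α = -γ := by rw [hγ]; ring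
      rw [this, hDL]
      calc (K : ℝ) ^ (-γ) ≤ (L / (64 * D)) ^ (-γ) :=
            Real.rpow_le_rpow_of_nonpos (by positivity) hKge (by linarith)
        _ = (64 * (D / L)) ^ γ := by
            rw [Real.rpow_neg (by positivity), ← Real.inv_rpow (by positivity), inv_div,
              mul_div_assoc]
    calc _ ≤ 3 * (2 ^ α * (64 ^ γ * (D / L) ^ γ)) := by gcongr
      _ = _ := by ring

/-- The number of nodes of the dense net with mesh `12 / (x √d)`, where the budget is `x ^ d`. -/
lemma two_pow_mul_choose_le {d : ℕ} (hd : 1 ≤ d) {x : ℝ} (hx : 24 ≤ x) :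
    (2 : ℝ) ^ d * (d + ⌈d * x / 12⌉₊).choose ⌈d * x / 12⌉₊ ≤ x ^ d := by
  have hd' : (1 : ℝ) ≤ d := by exact_mod_cast hd
  set K := ⌈d * x / 12⌉₊ with hK
  have hK1 : (K : ℝ) < d * x / 12 + 1 := Nat.ceil_lt_add_one (by positivity)
  rw [← Nat.choose_symm_add]
  calc (2 : ℝ) ^ d * (d + K).choose d ≤ 2 ^ d * (3 * (d + K : ℕ) / d) ^ d := by
        gcongr; exact choose_le_three_mul_div_pow hd
    _ = (2 * (3 * (d + K : ℕ) / d)) ^ d := by rw [mul_pow]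
    _ ≤ x ^ d := by
        gcongr
        rw [mul_div_assoc', div_le_iff₀ (by linarith)]
        push_cast
        nlinarith

lemma upper_bound_many_samples {α p : ℝ} (hα : 0 < α) (hp : 0 < p) (hp2 : p ≤ 2) :
    ∃ C : ℝ, 0 < C ∧ ∀ d n : ℕ, 1 ≤ d →
      2 ^ (d + 1) * (d + strictFloor α).choose (strictFloor α) < n →
      linSamplingNumber n (ridgeClass d α p) ≤ ENNReal.ofReal (C * ((n : ℝ) ^ (-α / d) *
        (d : ℝ) ^ (-α * (1 / max p 1 - 1 / 2)))) := by
  obtain ⟨C₀, hC₀, H⟩ := upper_bound_moderate_samples hα hp hp2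
  set s := strictFloor α with hs
  rw [max_comm p 1]
  set P := max 1 p with hP
  set B : ℝ := (2 : ℝ) ^ (α * (s + 2)) with hB
  refine ⟨max (C₀ * 24 ^ α) (3 * 12 ^ α) * B, by positivity, fun d n hd hn => ?_⟩
  have hd' : (1 : ℝ) ≤ d := by exact_mod_cast hd
  have hd0 : (0 : ℝ) < d := by linarith
  have hN : 0 < (d + s).choose s := Nat.choose_pos (by omega)
  have hN' : (0 : ℝ) < (d + s).choose s := by exact_mod_cast hN
  have hn0 : (0 : ℝ) < n := by exact_mod_cast (Nat.zero_le _).trans_lt hn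
  have hb1 : (2 : ℝ) ^ d < reducedBudget d s n := by
    rw [reducedBudget, lt_div_iff₀ (by positivity)]
    have : (2 ^ (d + 1) * (d + s).choose s : ℝ) < n := by exact_mod_cast hn
    rw [pow_succ] at this
    linarith
  set b := reducedBudget d s n with hb
  have hb0 : 0 < b := lt_trans (by positivity) hb1
  have hb1' : 1 ≤ b := (one_le_pow₀ (by norm_num : (1 : ℝ) ≤ 2)).trans hb1.le
  set x := b ^ (1 / d : ℝ) with hx
  have hx0 : 0 < x := by positivity
  have hxd : x ^ d = b := by
    rw [hx, ← Real.rpow_natCast, ← Real.rpow_mul hb0.le, one_div_mul_cancel hd0.ne', Real.rpow_one]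
  -- The factor `2 * binom (d+s) s ≤ 2 ^ (d+s+1)` costs only a constant after taking `d`-th roots.
  have hxn : x ^ (-α) ≤ B * (n : ℝ) ^ (-α / d) := by
    have h1 : (n : ℝ) ≤ b * 2 ^ ((d : ℝ) * (s + 2)) := by
      have h2 : (n : ℝ) = b * (2 * (d + s).choose s) := by
        rw [hb, reducedBudget]; field_simp
      rw [h2]
      gcongr
      have h3 : ((d + s).choose s : ℝ) ≤ 2 ^ (d + s) := by
        exact_mod_cast Nat.choose_le_two_pow (d + s) s
      calc (2 : ℝ) * (d + s).choose s ≤ 2 * 2 ^ (d + s) := by gcongr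
        _ = 2 ^ ((d + s + 1 : ℕ) : ℝ) := by rw [Real.rpow_natCast]; ring
        _ ≤ 2 ^ ((d : ℝ) * (s + 2)) := by
          apply Real.rpow_le_rpow_of_exponent_le (by norm_num)
          push_cast
          have : (0 : ℝ) ≤ s := by positivity
          nlinarith
    have h4 : (b * 2 ^ ((d : ℝ) * (s + 2))) ^ (-α / d) ≤ (n : ℝ) ^ (-α / d) := by
      apply Real.rpow_le_rpow_of_nonpos hn0 h1
      apply div_nonpos_of_nonpos_of_nonneg (by linarith) hd0.le
    rw [Real.mul_rpow hb0.le (by positivity), ← Real.rpow_mul (by norm_num)] at h4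
    have h5 : x ^ (-α) = b ^ (-α / d) := by
      rw [hx, ← Real.rpow_mul hb0.le]; congr 1; ring
    have h6 : B * (2 : ℝ) ^ ((d : ℝ) * (s + 2) * (-α / d)) = 1 := by
      rw [hB, ← Real.rpow_add (by norm_num)]
      have : α * ((s : ℝ) + 2) + (d : ℝ) * (s + 2) * (-α / d) = 0 := by field_simp; ring
      rw [this, Real.rpow_zero]
    calc x ^ (-α) = B * (b ^ (-α / d) * (2 : ℝ) ^ ((d : ℝ) * (s + 2) * (-α / d))) := by
          rw [h5, mul_left_comm, h6, mul_one]
      _ ≤ _ := by gcongr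
  set e := (d : ℝ) ^ (-α * (1 / P - 1 / 2)) with he
  have hfin : ∀ A, 0 ≤ A → A ≤ max (C₀ * 24 ^ α) (3 * 12 ^ α) →
      A * (x ^ (-α) * e) ≤
        max (C₀ * 24 ^ α) (3 * 12 ^ α) * B * ((n : ℝ) ^ (-α / d) * e) := by
    intro A hA0 hA
    calc A * (x ^ (-α) * e)
        ≤ max (C₀ * 24 ^ α) (3 * 12 ^ α) * (B * (n : ℝ) ^ (-α / d) * e) := by gcongr
      _ = _ := by ring
  by_cases hx24 : 24 ≤ x
  · set η : ℝ := 12 / (x * √d) with hη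
    have hη0 : 0 < η := by positivity
    set K := ⌈d * x / 12⌉₊ with hK
    have hK1 : √d ≤ η * K := by
      have h1 : d * x / 12 ≤ K := Nat.le_ceil _
      calc √d = η * (d * x / 12) := by
            rw [hη]
            have : √(d : ℝ) * √d = d := Real.mul_self_sqrt hd0.le
            field_simp
            nlinarith
        _ ≤ η * K := by gcongr
    have hcount : 2 ^ d * (d + K).choose K ≤ n / (d + s).choose s := by
      have h1 := (two_pow_mul_choose_le hd hx24).trans (hxd.le.trans (reducedBudget_le_div hb1'))
      exact_mod_cast h1
    obtain ⟨y, hy⟩ := isDualNet_dense hp hp2 hd hη0 hK1 hcount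
    have hr : 0 < η * (d : ℝ) ^ (1 - 1 / max 1 p) := by positivity
    refine (linSamplingNumber_le_of_isDualNet hα hp hp2 hr hy (Nat.div_mul_le_self _ _)).trans
      (ENNReal.ofReal_le_ofReal (le_trans (le_of_eq ?_) (hfin (3 * 12 ^ α) (by positivity)
        (le_max_right _ _))))
    have h1 : η * (d : ℝ) ^ (1 - 1 / max 1 p) = 12 * (x⁻¹ * (d : ℝ) ^ (-(1 / P - 1 / 2))) := by
      have h2 : (d : ℝ) ^ (-(1 / P - 1 / 2)) = (d : ℝ) ^ (1 - 1 / P) * (√d)⁻¹ := by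
        rw [Real.sqrt_eq_rpow, ← Real.rpow_neg hd0.le, ← Real.rpow_add hd0]
        congr 1; ring
      rw [h2, hη, ← hP]
      field_simp
    rw [h1, Real.mul_rpow (by norm_num) (by positivity), Real.mul_rpow (by positivity)
      (by positivity), ← Real.rpow_mul hd0.le, Real.inv_rpow hx0.le, ← Real.rpow_neg hx0.le, he]
    have : -(1 / P - 1 / 2) * α = -α * (1 / P - 1 / 2) := by ring
    rw [this]
    ring
  · push Not at hx24
    -- The budget exceeds `2 ^ d` by at most an exponential factor, so that the bound for
    -- the budget `2 ^ (d + 1) * binom (d + s) s` is already sufficient.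
    have h1 : 2 * d * (d + s).choose s < 2 ^ (d + 1) * (d + s).choose s := by
      have : d < 2 ^ d := Nat.lt_two_pow_self
      apply Nat.mul_lt_mul_of_pos_right _ hN
      rw [pow_succ]; omega
    have h2 := H d _ hd h1 le_rfl
    have hbud : reducedBudget d s (2 ^ (d + 1) * (d + s).choose s) = 2 ^ (d : ℝ) := by
      rw [reducedBudget, Real.rpow_natCast]
      push_cast
      field_simp
      ring
    rw [hbud, Real.logb_rpow (by norm_num) (by norm_num), div_self hd0.ne'] at h2
    have h3 : Real.logb 2 (1 + 1) = 1 := by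
      rw [show (1 + 1 : ℝ) = 2 by norm_num]; exact Real.logb_self_eq_one (by norm_num)
    rw [h3] at h2
    refine (linSamplingNumber_antitone hn.le _).trans (h2.trans (ENNReal.ofReal_le_ofReal
      (le_trans ?_ (hfin (C₀ * 24 ^ α) (by positivity) (le_max_left _ _)))))
    have h4 : (1 / (d : ℝ)) ^ (α * (1 / P - 1 / 2)) = e := by
      rw [he, one_div, Real.inv_rpow hd0.le, ← Real.rpow_neg hd0.le]
      congr 1; ring
    have h5 : (1 : ℝ) ≤ 24 ^ α * x ^ (-α) := by
      rw [Real.rpow_neg hx0.le, ← div_eq_mul_inv, one_le_div (by positivity)]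
      gcongr
    rw [h4]
    calc C₀ * e ≤ C₀ * ((24 ^ α * x ^ (-α)) * e) := by
          gcongr
          exact le_mul_of_one_le_left (by positivity) h5
      _ = _ := by ring

/-- The three upper bounds with a common constant. -/
lemma linear_upper_bound {α p : ℝ} (hα : 0 < α) (hp : 0 < p) (hp2 : p ≤ 2) {s : ℕ}
    (hs : s = strictFloor α) :
    ∃ C : ℝ, 0 < C ∧ ∀ d n : ℕ, 1 ≤ d →
      (n ≤ 2 * d * (d + s).choose s →
        linSamplingNumber n (ridgeClass d α p) ≤ ENNReal.ofReal C) ∧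
      (2 * d * (d + s).choose s < n → n ≤ 2 ^ (d + 1) * (d + s).choose s →
        linSamplingNumber n (ridgeClass d α p) ≤
          ENNReal.ofReal (C *
            (Real.logb 2 (1 + d / Real.logb 2 (reducedBudget d s n)) /
              Real.logb 2 (reducedBudget d s n)) ^ (α * (1 / max 1 p - 1 / 2)))) ∧
      (2 ^ (d + 1) * (d + s).choose s < n →
        linSamplingNumber n (ridgeClass d α p) ≤
          ENNReal.ofReal (C * ((n : ℝ) ^ (-α / d) *
            (d : ℝ) ^ (-α * (1 / max p 1 - 1 / 2))))) := by
  subst hs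
  obtain ⟨C₁, hC₁, H₁⟩ := upper_bound_moderate_samples hα hp hp2
  obtain ⟨C₂, hC₂, H₂⟩ := upper_bound_many_samples hα hp hp2
  refine ⟨1 + C₁ + C₂, by positivity, fun d n hd => ⟨fun _ => ?_, fun h h' => ?_, fun h => ?_⟩⟩
  · refine (linSamplingNumber_le_one hp hp2 d n).trans ?_
    rw [ENNReal.one_le_ofReal]
    linarith
  · refine (H₁ d n hd h h').trans (ENNReal.ofReal_le_ofReal ?_)
    have hN : (0 : ℝ) < (d + strictFloor α).choose (strictFloor α) := by
      exact_mod_cast Nat.choose_pos (by omega)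
    have hb : 1 ≤ reducedBudget d (strictFloor α) n := by
      rw [reducedBudget, one_le_div (by positivity)]
      have h1 : (2 * d * (d + strictFloor α).choose (strictFloor α) : ℝ) < n := by
        exact_mod_cast h
      have h2 : (1 : ℝ) ≤ d := by exact_mod_cast hd
      nlinarith
    have hL : 0 ≤ Real.logb 2 (reducedBudget d (strictFloor α) n) :=
      Real.logb_nonneg (by norm_num) hb
    have hD : 0 ≤ Real.logb 2 (1 + d / Real.logb 2 (reducedBudget d (strictFloor α) n)) := by
      apply Real.logb_nonneg (by norm_num)
      have : 0 ≤ (d : ℝ) / Real.logb 2 (reducedBudget d (strictFloor α) n) := by positivity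
      linarith
    gcongr
    linarith
  · refine (H₂ d n hd h).trans (ENNReal.ofReal_le_ofReal ?_)
    gcongr
    linarith

theorem mainTheorem2 (α p : ℝ) (hα : 0 < α) (hp : 0 < p) (hp2 : p ≤ 2) (s : ℕ)
    (hs : s = strictFloor α) :
    (∃ C : ℝ, 0 < C ∧ ∀ d n : ℕ, 1 ≤ d →
      (n ≤ 2 * d * (d + s).choose s →
        linSamplingNumber n (ridgeClass d α p) ≤ ENNReal.ofReal C) ∧
      (2 * d * (d + s).choose s < n → n ≤ 2 ^ (d + 1) * (d + s).choose s →
        linSamplingNumber n (ridgeClass d α p) ≤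
          ENNReal.ofReal (C *
            (Real.logb 2 (1 + d / Real.logb 2 (reducedBudget d s n)) /
              Real.logb 2 (reducedBudget d s n)) ^ (α * (1 / max 1 p - 1 / 2)))) ∧
      (2 ^ (d + 1) * (d + s).choose s < n →
        linSamplingNumber n (ridgeClass d α p) ≤
          ENNReal.ofReal (C * ((n : ℝ) ^ (-α / d) *
            (d : ℝ) ^ (-α * (1 / max p 1 - 1 / 2)))))) ∧
    (∃ c : ℝ, 0 < c ∧ ∀ d n : ℕ, 2 ≤ d →
      (n < d → ENNReal.ofReal c ≤ adaSamplingNumber n (ridgeClass d α p)) ∧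
      (d ≤ n → n < 2 ^ (d - 1) →
        ENNReal.ofReal (c *
            (Real.logb 2 (1 + d / (2 + Real.logb 2 n)) / (2 + Real.logb 2 n)) ^
              (α * (1 / p - 1 / 2))) ≤
          adaSamplingNumber n (ridgeClass d α p)) ∧
      (2 ^ (d - 1) ≤ n →
        ENNReal.ofReal (c * ((n : ℝ) ^ (-2 * α / ((d : ℝ) - 1)) *
            (d : ℝ) ^ (-α * (1 / p - 1 / 2)))) ≤
          adaSamplingNumber n (ridgeClass d α p))) := by
  exact ⟨linear_upper_bound hα hp hp2 hs, adaptive_lower_bound hα hp hp2⟩
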